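/- For $k \ge 1$ let $H'_k$ be the graph consisting of four disjoint triangles $A_1, A_2, B_1, B_2$, each with nodes labelled $1,2,3$, together with an edge between the nodes $1$ of $A_1$ and $A_2$, an edge between the nodes $1$ of $B_1$ and $B_2$, and, for each $i \in \{1,2\}$, $k$ internally disjoint paths of length $5$ joining node $2$ of $A_i$ to node $2$ of $B_i$. In the $\mathsf{CONGEST}$ model with bandwidth $b$, the input graph on $n$ nodes is the communication network; nodes have distinct identifiers $1,\dots,n$ and know $n$, their own identifier and those of their neighbours; in each synchronous round every node may send a (possibly different) message of at most $b$ bits to each of its neighbours, and local computation is unlimited. An algorithm solves $H$-detection (induced $H$-detection) in $T$ rounds on a class of graphs if on every input graph $G$ of the class, after $T$ rounds, at least one node accepts if $G$ contains $H$ as a subgraph (as an induced subgraph), and no node accepts otherwise. A randomized algorithm (shared randomness is allowed) has to be correct in this sense with probability at least $2/3$ on every input graph of the class. The degeneracy of a graph is the least $d$ such that every nonempty induced subgraph has a vertex of degree at most $d$. **Theorem.** Let $k \ge 2$. 1. The graph $H'_k$ has treewidth $2$, and there are $c > 0$ and $n_0$, depending only on $k$, such that for all $n \ge n_0$ and all $b$,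 every deterministic or randomized $\mathsf{CONGEST}$ algorithm with bandwidth $b$ that solves $H'_k$-detection or induced $H'_k$-detection on the $n$-node graphs of degeneracy $2$ in $T$ rounds satisfies $b\,T \ge c\, n^{1-1/k}$. In particular, with bandwidth $b = O(\log n)$, it needs $\Omega(n^{1-1/k}/\log n)$ rounds. 2. There is a graph $H_k$ of treewidth $2$ such that every deterministic or randomized $\mathsf{CONGEST}$ algorithm with bandwidth $O(\log n)$ that solves $H_k$-detection or induced $H_k$-detection on graphs of degeneracy $2$ needs $\Omega(n^{1-1/k})$ rounds, where the implied constant depends only on $k$ and the constant in the bandwidth. -/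

import Mathlib

open MeasureTheory
open scoped ENNReal

/-! ## Graph parameters -/

open Classical in
/-- Every nonempty (finite) induced subgraph of `G` has a vertex of degree at most `d`. -/
def IsDegenerate {V : Type*} (G : SimpleGraph V) (d : ℕ) : Prop :=
  ∀ S : Finset V, S.Nonempty → ∃ v ∈ S, (S.filter fun w => G.Adj v w).card ≤ d

/-- The degeneracy of a finite graph: the least `d` such that `G` is `d`-degenerate. -/
noncomputable def degeneracy {V : Type*} (G : SimpleGraph V) : ℕ :=
  sInf {d | IsDegenerate G d}

/-- A tree decomposition of `G`: a tree `tree` on `{0, …, size - 1}` and a bag for each of its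
nodes, such that the bags cover the vertices, each edge lies in a bag, and whenever `j` is on the
path from `i` to `l` in the tree, the bag of `j` contains the intersection of those of
`i` and `l`. -/
structure TreeDecomposition {V : Type*} (G : SimpleGraph V) where
  size : ℕ
  tree : SimpleGraph (Fin size)
  bag : Fin size → Finset V
  isTree : tree.IsTree
  cover_vertex : ∀ v : V, ∃ i, v ∈ bag i
  cover_edge : ∀ u v : V, G.Adj u v → ∃ i, u ∈ bag i ∧ v ∈ bag i
  path_inter : ∀ (i j l : Fin size) (p : tree.Walk i l), p.IsPath → j ∈ p.support →
    ∀ v : V, v ∈ bag i → v ∈ bag l → v ∈ bag j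

/-- The width of a tree decomposition: the maximum size of a bag, minus one. -/
def TreeDecomposition.width {V : Type*} {G : SimpleGraph V} (D : TreeDecomposition G) : ℕ :=
  (Finset.univ.sup fun i => (D.bag i).card) - 1

/-- The treewidth of a finite (nonempty) graph: the least width of a tree decomposition. -/
noncomputable def treewidth {V : Type*} (G : SimpleGraph V) : ℕ :=
  sInf {w | ∃ D : TreeDecomposition G, D.width = w}

/-! ## The pattern graph -/

/-- Vertices of the pattern graph. `Sum.inl (s, i, l)` is the node with label `l` (labels `0, 1, 2`
stand for `1, 2, 3`) of the `i`-th triangle on side `s` (side `0` is `A`, side `1` is `B`).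
`Sum.inr (i, p, q)` is the `q`-th inner node of the `p`-th path joining the `i`-th triangle of
side `A` to the `i`-th triangle of side `B`. -/
abbrev PatternVertex (k : ℕ) : Type :=
  (Fin 2 × Fin 2 × Fin 3) ⊕ (Fin 2 × Fin k × Fin 4)

/-- The edges of the pattern graph, each listed in at least one direction. -/
def patternRel (k : ℕ) : PatternVertex k → PatternVertex k → Prop
  | .inl (s, i, l), .inl (s', i', l') =>
      -- the four triangles
      (s = s' ∧ i = i' ∧ l ≠ l') ∨
      -- an edge between the first nodes of the two triangles of the same side
      (s = s' ∧ i ≠ i' ∧ l = 0 ∧ l' = 0)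
  | .inl (s, i, l), .inr (i', _, q) =>
      -- a path starts in the second node of the triangle of side `A` and
      -- ends in the second node of the triangle of side `B`
      i = i' ∧ l = 1 ∧ ((s = 0 ∧ q = 0) ∨ (s = 1 ∧ q = 3))
  | .inr (i, p, q), .inr (i', p', q') =>
      -- consecutive inner nodes of a path
      i = i' ∧ p = p' ∧ q.val + 1 = q'.val
  | .inr _, .inl _ => False

/-- The pattern graph: triangles `A₁, A₂, B₁, B₂`; the first nodes of `A₁, A₂` are adjacent, so are
the first nodes of `B₁, B₂`; and for `i = 1, 2` the second nodes of `Aᵢ` and `Bᵢ` are joined by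
`k` internally disjoint paths of length `5` (four inner nodes each). -/
def patternGraph (k : ℕ) : SimpleGraph (PatternVertex k) :=
  SimpleGraph.fromRel (patternRel k)

/-! ## The CONGEST model -/

/-- A message of at most `b` bits (the empty message means silence). -/
abbrev Message (b : ℕ) : Type := {l : List Bool // l.length ≤ b}

/-- A deterministic algorithm for networks on `n` nodes with identifiers in `Fin n` and bandwidth
`b`. Nodes know `n`, their identifier and the identifiers of their neighbours, and local
computation is unlimited. In every round each node sends to each of its neighbours a message of at
most `b` bits that may depend on the recipient, and then updates its state from
the messages received. -/
structure CongestAlgorithm (n b : ℕ) where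
  /-- The local states. -/
  State : Type
  /-- The initial state, from the own identifier and the set of identifiers of the neighbours. -/
  init : Fin n → Set (Fin n) → State
  /-- The message sent in a given state to the neighbour with the given identifier. -/
  send : State → Fin n → Message b
  /-- The new state, from the old one and the message received from each neighbour
  (`none` for nodes that are not neighbours). -/
  update : State → (Fin n → Option (Message b)) → State
  /-- Whether a node accepts, that is, reports a yes-instance. -/
  output : State → Bool

open Classical in
/-- The state of each node of the network `G` after `t` rounds. -/
noncomputable def CongestAlgorithm.stateAfter {n b : ℕ} (A : CongestAlgorithm n b)
    (G : SimpleGraph (Fin n)) : ℕ → Fin n → A.State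
  | 0, v => A.init v (G.neighborSet v)
  | t + 1, v => A.update (A.stateAfter G t v) fun u =>
      if G.Adj v u then some (A.send (A.stateAfter G t u) v) else none

/-- After `T` rounds on the network `G`, some node accepts. -/
def CongestAlgorithm.Accepts {n b : ℕ} (A : CongestAlgorithm n b) (T : ℕ)
    (G : SimpleGraph (Fin n)) : Prop :=
  ∃ v, A.output (A.stateAfter G T v) = true

/-- Run for `T` rounds on `G`, the algorithm answers correctly whether `G` has the property `P`:
some node accepts if `G` has it, and no node accepts otherwise. -/
def CongestAlgorithm.CorrectOn {n b : ℕ} (A : CongestAlgorithm n b) (T : ℕ)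
    (P : SimpleGraph (Fin n) → Prop) (G : SimpleGraph (Fin n)) : Prop :=
  A.Accepts T G ↔ P G

/-- A randomized algorithm: a random deterministic algorithm. The randomness is visible to all
nodes; private coins are the case in which `Ω` is a product over the identifiers and each
node uses only its own coordinate. -/
structure RandomizedCongestAlgorithm (n b : ℕ) where
  Ω : Type
  [measurableSpace : MeasurableSpace Ω]
  μ : Measure Ω
  [isProbabilityMeasure : IsProbabilityMeasure μ]
  alg : Ω → CongestAlgorithm n b

/-- Some deterministic algorithm with bandwidth `b` decides in `T` rounds the property `P` on all
`n`-node networks in the class `F`. -/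
def DetSolvable {n : ℕ} (b T : ℕ) (F P : SimpleGraph (Fin n) → Prop) : Prop :=
  ∃ A : CongestAlgorithm n b, ∀ G, F G → A.CorrectOn T P G

/-- Some randomized algorithm with bandwidth `b` decides in `T` rounds the property `P` on all
`n`-node networks in the class `F`, with error probability at most `1/3` on each of them.
(For an event that is not measurable, `μ` is the outer measure, so that
then the error event is covered by a measurable one of probability at most `1/3`.) -/
def RandSolvable {n : ℕ} (b T : ℕ) (F P : SimpleGraph (Fin n) → Prop) : Prop :=
  ∃ A : RandomizedCongestAlgorithm n b, ∀ G, F G →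
    A.μ {ω | ¬ (A.alg ω).CorrectOn T P G} ≤ (1 / 3 : ℝ≥0∞)

/-- With bandwidth `b` and in `T` rounds, some deterministic or randomized algorithm solves
`H`-detection or induced `H`-detection on all `n`-node networks of degeneracy `2`. -/
def DetectableOnDegeneracyTwo {W : Type} (H : SimpleGraph W) (n b T : ℕ) : Prop :=
  DetSolvable (n := n) b T (fun G => degeneracy G = 2) (fun G => H.IsContained G) ∨
  DetSolvable (n := n) b T (fun G => degeneracy G = 2) (fun G => H.IsIndContained G) ∨
  RandSolvable (n := n) b T (fun G => degeneracy G = 2) (fun G => H.IsContained G) ∨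
  RandSolvable (n := n) b T (fun G => degeneracy G = 2) (fun G => H.IsIndContained G)

/-! The lower bound is a reduction from set disjointness on the universe of words `w : Fin k → Fin
r`. In `hostGraph x y`, every word has a copy of each pattern triangle, tied through subdivision
nodes to the `k` hubs `(p, w p)`; equal hubs of the two sides are matched, and `x`, `y` decide which
pairs of triangles on a side are joined. A word in both sets yields the pattern. Conversely, the
host has no triangles but these copies, an edge between two of them certifies membership in `x` or
`y`, and the `k` paths through the hubs visit all `k` positions, so both sides carry the same word
(`exists_of_patternGraph_isContained_hostGraph`). Thus `r ^ k` input bits live on `O(r ^ k)`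
vertices with only `O(k r)` edges across the cut, at degeneracy 2.

By `CongestAlgorithm.exists_rectangles`, an algorithm splits the rejected inputs into `exp (O(k r b
T))` disjoint rectangles; by `card_le_log_card_rectangles`, the logarithm of their number is `Ω(r ^
k)`. Hence `b T = Ω(r ^ (k - 1))`, which is `n ^ (1 - 1/k)` up to constants. Randomness is removed
by averaging over the hard distribution.

That distribution splits the universe at random into `d` and its complement, gives each player a
random subset of one part, and forces a coordinate `i` into both sets or out of both. For a
rectangle, the effect of forcing `i` is a correlation of an indicator with one bit, and by an
exponential moment bound a set has large total correlation only if it is exponentially small. Few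
disjoint rectangles therefore cannot tell the two cases apart.

The treewidth is at most 2 by an explicit elimination order and at least 2 because a triangle lies
in one bag. The second claim takes the pattern with `k + 1` paths: its larger exponent absorbs the
logarithm. -/

/-! ## The randomized communication complexity of set disjointness -/

section Disjointness

variable {ι : Type} [DecidableEq ι]

/-- The character of one bit. -/
def bitSign (c : Bool) : ℝ := if c then -1 else 1

/-- Coordinatewise conjunction. -/
def mask (z d : ι → Bool) : ι → Bool := fun j => z j && d j

/-- Flip one coordinate. -/
def flipAt (i : ι) : Equiv.Perm (ι → Bool) :=
  Function.Involutive.toPerm (fun d => Function.update d i (!d i)) (by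
    intro d
    funext j
    by_cases h : j = i
    · subst h; simp
    · simp [h])

theorem flipAt_same (i : ι) (d : ι → Bool) : flipAt i d i = !d i :=
  Function.update_self ..

theorem flipAt_of_ne {i j : ι} (h : j ≠ i) (d : ι → Bool) : flipAt i d j = d j :=
  Function.update_of_ne h ..

/-- The index set of the hard input distribution. -/
abbrev HardSample (ι : Type) : Type :=
  Bool × ι × (ι → Bool) × (ι → Bool) × (ι → Bool)

/-- The first player's input: a random set with element `i` forced in or out. -/
def HardSample.fst : HardSample ι → ι → Bool
  | (c, i, d, z, _) => Function.update (mask z d) i c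

/-- The second player's input: off `i` it is disjoint from the first player's. -/
def HardSample.snd : HardSample ι → ι → Bool
  | (c, i, d, _, w) => Function.update (mask w fun j => !d j) i c

theorem HardSample.intersects_iff (j : HardSample ι) :
    (∃ i, j.fst i = true ∧ j.snd i = true) ↔ j.1 = true := by
  obtain ⟨c, i, d, z, w⟩ := j
  simp only [HardSample.fst, HardSample.snd]
  constructor
  · rintro ⟨l, h1, h2⟩
    by_cases hl : l = i
    · subst hl; simpa using h1
    · simp [hl, mask] at h1 h2
      simp [h1.2] at h2
  · intro hc
    exact ⟨i, by simpa using hc, by simpa using hc⟩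

variable [Fintype ι]

/-- The sum of `h` over all inputs supported on `d`, with bit `i` fixed to `c`. -/
noncomputable def fixedSum (h : (ι → Bool) → ℝ) (i : ι) (c : Bool) (d : ι → Bool) : ℝ :=
  ∑ z : ι → Bool, h (Function.update (mask z d) i c)

/-! ### Exponential moments: how much a bounded function correlates with single bits. -/

theorem sum_exp_bitSign_le (I : Finset ι) (lam : ℝ) :
    ∑ z : ι → Bool, Real.exp (lam * ∑ i ∈ I, bitSign (z i)) ≤
      2 ^ Fintype.card ι * Real.exp (Fintype.card ι * (lam ^ 2 / 2)) := by
  have h1 : ∀ z : ι → Bool, Real.exp (lam * ∑ i ∈ I, bitSign (z i)) =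
      ∏ i, Real.exp (if i ∈ I then lam * bitSign (z i) else 0) := by
    intro z
    rw [← Real.exp_sum, Finset.mul_sum, ← Finset.sum_filter]
    simp
  simp_rw [h1]
  have h2 := Finset.prod_univ_sum (fun _ : ι => (Finset.univ : Finset Bool))
    (fun i c => Real.exp (if i ∈ I then lam * bitSign c else 0))
  rw [Fintype.piFinset_univ] at h2
  rw [← h2, Real.exp_nat_mul, ← mul_pow]
  have h3 : ∀ i ∈ (Finset.univ : Finset ι),
      ∑ c : Bool, Real.exp (if i ∈ I then lam * bitSign c else 0) ≤
        2 * Real.exp (lam ^ 2 / 2) := by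
    intro i _
    have hc := Real.cosh_le_exp_half_sq lam
    have h0 : 1 ≤ Real.exp (lam ^ 2 / 2) := Real.one_le_exp (by positivity)
    rw [Real.cosh_eq] at hc
    by_cases hi : i ∈ I
    · simp only [hi, if_true, Fintype.sum_bool, bitSign]
      simp
      linarith
    · simp only [hi, if_false, Fintype.sum_bool]
      simp
      linarith
  refine (Finset.prod_le_prod (fun i _ => ?_) h3).trans_eq ?_
  · positivity
  · simp

/-- Pointwise `φ ≤ s + exp (φ - s)`; weight this by `h`, using `h ≤ 1` only on the exponential term,
and sum. The first term is proportional to the mass of `h`, the second is a fixed cost which a large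
`s` makes negligible. -/
theorem sum_mul_bitSign_le (h : (ι → Bool) → ℝ) (h0 : ∀ z, 0 ≤ h z) (h1 : ∀ z, h z ≤ 1)
    (I : Finset ι) (lam s : ℝ) :
    lam * ∑ i ∈ I, ∑ z, h z * bitSign (z i) ≤
      s * ∑ z, h z +
        Real.exp (-s) * (2 ^ Fintype.card ι * Real.exp (Fintype.card ι * (lam ^ 2 / 2))) := by
  have hpt : ∀ z : ι → Bool, h z * (lam * ∑ i ∈ I, bitSign (z i)) ≤
      s * h z + Real.exp (-s) * Real.exp (lam * ∑ i ∈ I, bitSign (z i)) := by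
    intro z
    set φ := lam * ∑ i ∈ I, bitSign (z i)
    rw [← Real.exp_add]
    have e1 := Real.add_one_le_exp (-s + φ)
    have e2 := Real.exp_pos (-s + φ)
    have := mul_le_mul_of_nonneg_left (show φ ≤ s + Real.exp (-s + φ) by linarith) (h0 z)
    have := mul_le_mul_of_nonneg_right (h1 z) e2.le
    linarith
  have hsum := Finset.sum_le_sum fun z (_ : z ∈ Finset.univ) => hpt z
  rw [Finset.sum_add_distrib, ← Finset.mul_sum, ← Finset.mul_sum] at hsum
  have hmgf := mul_le_mul_of_nonneg_left (sum_exp_bitSign_le I lam) (Real.exp_pos (-s)).le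
  have heq : lam * ∑ i ∈ I, ∑ z, h z * bitSign (z i) =
      ∑ z, h z * (lam * ∑ i ∈ I, bitSign (z i)) := by
    rw [Finset.sum_comm, Finset.mul_sum]
    refine Finset.sum_congr rfl fun z _ => ?_
    rw [Finset.mul_sum, Finset.mul_sum, Finset.mul_sum]
    exact Finset.sum_congr rfl fun i _ => by ring
  linarith

theorem sum_eq_two_mul_of_flipAt (i : ι) (a : (ι → Bool) → ℝ) (ha : ∀ d, a (flipAt i d) = a d) :
    ∑ d, a d = 2 * ∑ d, if d i then a d else 0 := by
  have h1 : ∑ d, a d = ∑ d, (if d i then a d else 0) + ∑ d, (if d i then 0 else a d) := by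
    rw [← Finset.sum_add_distrib]
    exact Finset.sum_congr rfl fun d _ => by split_ifs <;> simp
  have h2 : ∑ d, (if d i then 0 else a d) = ∑ d, if d i then a d else 0 := by
    rw [← Equiv.sum_comp (flipAt i)]
    refine Finset.sum_congr rfl fun d _ => ?_
    rw [flipAt_same, ha]
    cases d i <;> simp
  rw [h1, h2]
  ring

theorem fixedSum_congr (h : (ι → Bool) → ℝ) (i : ι) (c : Bool) {d d' : ι → Bool}
    (hd : ∀ j, j ≠ i → d j = d' j) : fixedSum h i c d = fixedSum h i c d' := by
  unfold fixedSum
  refine Finset.sum_congr rfl fun z _ => congrArg h ?_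
  funext j
  by_cases hj : j = i
  · subst hj; simp
  · simp [hj, mask, hd j hj]

/-- Off `d` the forced bit is already `false`. The right side no longer depends on `i`, so this
factor can later be pulled out of the sum over `i`. -/
theorem fixedSum_false (h : (ι → Bool) → ℝ) {i : ι} {d : ι → Bool} (hd : d i = false) :
    fixedSum h i false d = ∑ z, h (mask z d) := by
  unfold fixedSum
  refine Finset.sum_congr rfl fun z _ => congrArg h ?_
  funext j
  by_cases hj : j = i
  · subst hj; simp [mask, hd]
  · simp [hj]

/-- Pair each `z` with its flip at `i`. The forced sums ignore `z i`, so they count each input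
twice; hence the factor 2. -/
theorem fixedSum_sub (h : (ι → Bool) → ℝ) {i : ι} {d : ι → Bool} (hd : d i = true) :
    fixedSum h i false d - fixedSum h i true d =
      2 * ∑ z, h (mask z d) * bitSign (z i) := by
  have h1 : ∑ z, h (mask z d) * bitSign (z i) =
      ∑ z, h (mask (flipAt i z) d) * bitSign (flipAt i z i) :=
    (Equiv.sum_comp (flipAt i) fun z => h (mask z d) * bitSign (z i)).symm
  have h2 : fixedSum h i false d - fixedSum h i true d =
      ∑ z, h (mask z d) * bitSign (z i) +
        ∑ z, h (mask (flipAt i z) d) * bitSign (flipAt i z i) := by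
    unfold fixedSum
    rw [← Finset.sum_sub_distrib, ← Finset.sum_add_distrib]
    refine Finset.sum_congr rfl fun z _ => ?_
    have e1 : ∀ z : ι → Bool, Function.update (mask z d) i (z i) = mask z d := fun z => by
      rw [show z i = mask z d i by simp [mask, hd], Function.update_eq_self]
    have e2 : Function.update (mask z d) i (!z i) = mask (flipAt i z) d := by
      rw [← e1 (flipAt i z), flipAt_same]
      funext j
      by_cases hj : j = i
      · subst hj; simp
      · simp [hj, mask, flipAt_of_ne hj]
    have e3 := e1 z
    rw [flipAt_same, ← e2]
    cases hz : z i <;> rw [hz] at e3 <;> simp [bitSign, e3] <;> ring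
  rw [h2, ← h1]
  ring

variable {τ : Type} [Fintype τ]

/-- No summand depends on `d i`, so it costs only a factor 2 to restrict to `d i = true`. Then the
`g`-factor is free of `i` and the `f`-factor is a positive part of a bit correlation, to which
`sum_mul_bitSign_le` applies. The masses of the rectangles add up by `hfg`, and `hs` makes the fixed
cost per rectangle affordable. -/
theorem sum_fixedSum_sub_mul_le (f g : τ → (ι → Bool) → ℝ)
    (hf0 : ∀ t x, 0 ≤ f t x) (hf1 : ∀ t x, f t x ≤ 1)
    (hg0 : ∀ t x, 0 ≤ g t x) (hg1 : ∀ t x, g t x ≤ 1)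
    (hfg : ∀ x y, ∑ t, f t x * g t y ≤ 1) {lam s : ℝ} (hlam : 0 < lam) (hs0 : 0 ≤ s)
    (hs : Fintype.card τ * Real.exp (Fintype.card ι * (lam ^ 2 / 2)) ≤ Real.exp s) :
    ∑ d : ι → Bool, ∑ i, ∑ t,
      max (fixedSum (f t) i false d - fixedSum (f t) i true d) 0 *
        fixedSum (g t) i false (fun j => !d j) ≤
      (2 ^ Fintype.card ι) ^ 3 * (4 * (s + 1) / lam) := by
  set K : ℝ := 2 ^ Fintype.card ι with hK
  have hK0 : 0 < K := by positivity
  have hcard : ((Finset.univ : Finset (ι → Bool)).card : ℝ) = K := by simp [hK]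
  let a : ι → (ι → Bool) → ℝ := fun i d => ∑ t,
    max (fixedSum (f t) i false d - fixedSum (f t) i true d) 0 *
      fixedSum (g t) i false (fun j => !d j)
  have hflip : ∀ i d, a i (flipAt i d) = a i d := by
    intro i d
    refine Finset.sum_congr rfl fun t _ => ?_
    have e : ∀ j, j ≠ i → flipAt i d j = d j := fun j hj => flipAt_of_ne hj d
    rw [fixedSum_congr (f t) i false e, fixedSum_congr (f t) i true e,
      fixedSum_congr (g t) i false (d' := fun j => !d j) fun j hj => by rw [e j hj]]
  have hd : ∀ d, ∑ i, (if d i then a i d else 0) ≤ K ^ 2 * (2 * (s + 1) / lam) := by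
    intro d
    let Γ : τ → ℝ := fun t => ∑ w, g t (mask w fun j => !d j)
    let Φ : τ → ℝ := fun t => ∑ z, f t (mask z d)
    have hΓ0 : ∀ t, 0 ≤ Γ t := fun t => Finset.sum_nonneg fun w _ => hg0 _ _
    have hΓK : ∀ t, Γ t ≤ K := fun t => by
      refine (Finset.sum_le_sum fun w _ => hg1 t _).trans_eq ?_
      rw [Finset.sum_const, nsmul_eq_mul, mul_one, hcard]
    have h1 : ∑ i, (if d i then a i d else 0) =
        ∑ t, Γ t * ∑ i, if d i then
          max (fixedSum (f t) i false d - fixedSum (f t) i true d) 0 else 0 := by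
      simp_rw [Finset.mul_sum]
      rw [Finset.sum_comm]
      refine Finset.sum_congr rfl fun i _ => ?_
      by_cases hdi : d i = true
      · simp only [hdi, if_true, a]
        refine Finset.sum_congr rfl fun t _ => ?_
        rw [fixedSum_false (g t) (d := fun j => !d j) (by simp [hdi]), mul_comm]
      · simp [hdi]
    have h2 : ∀ t, lam * ∑ i, (if d i then
        max (fixedSum (f t) i false d - fixedSum (f t) i true d) 0 else 0) ≤
        2 * (s * Φ t + Real.exp (-s) * (K * Real.exp (Fintype.card ι * (lam ^ 2 / 2)))) := by
      intro t
      -- Restricting to the coordinates of positive correlation turns the sum of positive parts into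
      -- a plain sum.
      let I : Finset ι := Finset.univ.filter fun i =>
        d i = true ∧ 0 < ∑ z, f t (mask z d) * bitSign (z i)
      have e : ∑ i, (if d i then
          max (fixedSum (f t) i false d - fixedSum (f t) i true d) 0 else 0) =
          2 * ∑ i ∈ I, ∑ z, f t (mask z d) * bitSign (z i) := by
        rw [Finset.sum_filter, Finset.mul_sum]
        refine Finset.sum_congr rfl fun i _ => ?_
        by_cases hdi : d i = true
        · rw [if_pos hdi, fixedSum_sub (f t) hdi]
          by_cases hp : 0 < ∑ z, f t (mask z d) * bitSign (z i)
          · rw [if_pos ⟨hdi, hp⟩, max_eq_left (by linarith)]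
          · rw [if_neg (fun h => hp h.2), max_eq_right (by linarith), mul_zero]
        · rw [if_neg hdi, if_neg (fun h => hdi h.1), mul_zero]
      have := sum_mul_bitSign_le (fun z => f t (mask z d)) (fun z => hf0 t _) (fun z => hf1 t _)
        I lam s
      rw [e]
      linarith
    have h3 : ∑ t, Γ t * Φ t ≤ K ^ 2 := by
      have e : ∑ t, Γ t * Φ t =
          ∑ w : ι → Bool, ∑ z : ι → Bool, ∑ t, f t (mask z d) * g t (mask w fun j => !d j) := by
        simp_rw [Γ, Φ, Finset.sum_mul_sum]
        rw [Finset.sum_comm]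
        refine Finset.sum_congr rfl fun w _ => ?_
        rw [Finset.sum_comm]
        refine Finset.sum_congr rfl fun z _ => Finset.sum_congr rfl fun t _ => mul_comm _ _
      rw [e]
      refine (Finset.sum_le_sum fun w _ => Finset.sum_le_sum fun z _ => hfg _ _).trans_eq ?_
      rw [Finset.sum_const, Finset.sum_const, nsmul_eq_mul, nsmul_eq_mul, mul_one, hcard, sq]
    set E := Real.exp (-s) * (K * Real.exp (Fintype.card ι * (lam ^ 2 / 2))) with hE
    have hE0 : 0 ≤ E := by positivity
    have h4 : ∑ t, Γ t * E ≤ K ^ 2 := by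
      have hcE : (Fintype.card τ : ℝ) * E ≤ K := by
        have := mul_le_mul_of_nonneg_left hs (by positivity : 0 ≤ K * Real.exp (-s))
        rw [mul_assoc K (Real.exp (-s)) (Real.exp s), ← Real.exp_add, neg_add_cancel, Real.exp_zero, mul_one] at this
        rw [hE]
        linarith
      calc ∑ t, Γ t * E ≤ ∑ _t : τ, K * E :=
            Finset.sum_le_sum fun t _ => mul_le_mul_of_nonneg_right (hΓK t) hE0
        _ = K * (Fintype.card τ * E) := by
            rw [Finset.sum_const, nsmul_eq_mul, Finset.card_univ]; ring
        _ ≤ K * K := mul_le_mul_of_nonneg_left hcE hK0.le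
        _ = K ^ 2 := (sq K).symm
    have h5 : lam * ∑ i, (if d i then a i d else 0) ≤ 2 * (s + 1) * K ^ 2 := by
      rw [h1, Finset.mul_sum]
      calc ∑ t, lam * (Γ t * ∑ i, if d i then
              max (fixedSum (f t) i false d - fixedSum (f t) i true d) 0 else 0)
          ≤ ∑ t, Γ t * (2 * (s * Φ t + E)) := Finset.sum_le_sum fun t _ => by
            rw [mul_left_comm]
            exact mul_le_mul_of_nonneg_left (h2 t) (hΓ0 t)
        _ = 2 * s * ∑ t, Γ t * Φ t + 2 * ∑ t, Γ t * E := by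
            rw [Finset.mul_sum, Finset.mul_sum, ← Finset.sum_add_distrib]
            exact Finset.sum_congr rfl fun t _ => by ring
        _ ≤ 2 * (s + 1) * K ^ 2 := by
            have := mul_le_mul_of_nonneg_left h3 hs0
            linarith
    rw [show K ^ 2 * (2 * (s + 1) / lam) = (2 * (s + 1) * K ^ 2) / lam by ring,
      le_div_iff₀ hlam, mul_comm]
    exact h5
  calc ∑ d : ι → Bool, ∑ i, a i d = ∑ i, ∑ d, a i d := Finset.sum_comm
    _ = ∑ i, 2 * ∑ d : ι → Bool, (if d i then a i d else 0) :=
        Finset.sum_congr rfl fun i _ => sum_eq_two_mul_of_flipAt i (a i) (hflip i)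
    _ = 2 * ∑ d : ι → Bool, ∑ i, (if d i then a i d else 0) := by
        rw [← Finset.mul_sum, Finset.sum_comm]
    _ ≤ 2 * ∑ _d : ι → Bool, K ^ 2 * (2 * (s + 1) / lam) :=
        mul_le_mul_of_nonneg_left (Finset.sum_le_sum fun d _ => hd d) (by norm_num)
    _ = K ^ 3 * (4 * (s + 1) / lam) := by
        rw [Finset.sum_const, nsmul_eq_mul, hcard]; ring

theorem fixedSum_nonneg {h : (ι → Bool) → ℝ} (h0 : ∀ z, 0 ≤ h z) (i : ι) (c : Bool)
    (d : ι → Bool) : 0 ≤ fixedSum h i c d :=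
  Finset.sum_nonneg fun _ _ => h0 _

/-- A telescoped difference of products in which both weights `b₀`, `a₀` belong to the bit `false`,
as `sum_fixedSum_sub_mul_le` requires. -/
theorem mul_sub_mul_le_max {a₀ a₁ b₀ b₁ : ℝ} (ha₁ : 0 ≤ a₁) (hb₀ : 0 ≤ b₀)
    (hb₁ : 0 ≤ b₁) : a₀ * b₀ - a₁ * b₁ ≤ max (a₀ - a₁) 0 * b₀ + max (b₀ - b₁) 0 * a₀ := by
  rcases le_total a₁ a₀ with h | h <;> rcases le_total b₁ b₀ with h' | h'
  · rw [max_eq_left (by linarith), max_eq_left (by linarith)]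
    nlinarith [mul_nonneg (sub_nonneg.2 h) (sub_nonneg.2 h')]
  · rw [max_eq_left (by linarith), max_eq_right (by linarith)]
    nlinarith [mul_nonneg ha₁ (sub_nonneg.2 h')]
  · rw [max_eq_right (by linarith), max_eq_left (by linarith)]
    nlinarith [mul_nonneg hb₁ (sub_nonneg.2 h)]
  · rw [max_eq_right (by linarith), max_eq_right (by linarith)]
    nlinarith [mul_le_mul h h' hb₀ ha₁]

open Classical in
/-- A deterministic protocol that decides intersection with error at most `1/3` on the hard
distribution has exponentially many rectangles. -/
theorem card_le_log_card_rectangles (S U : τ → (ι → Bool) → Prop)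
    (accept : (ι → Bool) → (ι → Bool) → Prop)
    (hrej : ∀ x y, ¬ accept x y ↔ ∃ t, S t x ∧ U t y)
    (huniq : ∀ x y t t', S t x → U t y → S t' x → U t' y → t = t')
    (herr : 3 * (Finset.univ.filter fun j : HardSample ι =>
      ¬ (accept j.fst j.snd ↔ ∃ i, j.fst i = true ∧ j.snd i = true)).card ≤
        Fintype.card (HardSample ι)) :
    (Fintype.card ι : ℝ) ≤ 1152 * (Real.log (Fintype.card τ) + 1) := by
  set K : ℝ := 2 ^ Fintype.card ι with hK
  set N : ℝ := ((Fintype.card ι : ℕ) : ℝ) with hN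
  have hK0 : 0 < K := by positivity
  have hN0 : 0 ≤ N := by positivity
  let f : τ → (ι → Bool) → ℝ := fun t x => if S t x then 1 else 0
  let g : τ → (ι → Bool) → ℝ := fun t x => if U t x then 1 else 0
  have hf0 : ∀ t x, 0 ≤ f t x := fun t x => by simp only [f]; split_ifs <;> norm_num
  have hf1 : ∀ t x, f t x ≤ 1 := fun t x => by simp only [f]; split_ifs <;> norm_num
  have hg0 : ∀ t x, 0 ≤ g t x := fun t x => by simp only [g]; split_ifs <;> norm_num
  have hg1 : ∀ t x, g t x ≤ 1 := fun t x => by simp only [g]; split_ifs <;> norm_num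
  have hsum : ∀ x y, ∑ t, f t x * g t y = if accept x y then 0 else 1 := by
    intro x y
    have e : ∀ t, f t x * g t y = if S t x ∧ U t y then 1 else 0 := fun t => by
      by_cases h : S t x <;> by_cases h' : U t y <;> simp [f, g, h, h']
    simp_rw [e]
    by_cases h : accept x y
    · rw [if_pos h]
      refine Finset.sum_eq_zero fun t _ => if_neg fun ht => (hrej x y).2 ⟨t, ht⟩ h
    · rw [if_neg h]
      obtain ⟨t, ht⟩ := (hrej x y).1 h
      rw [Finset.sum_eq_single t, if_pos ht]
      · intro t' _ hne
        exact if_neg fun ht' => hne (huniq x y t' t ht'.1 ht'.2 ht.1 ht.2)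
      · simp
  have hfg : ∀ x y, ∑ t, f t x * g t y ≤ 1 := fun x y => by
    rw [hsum]; split_ifs <;> norm_num
  rcases Nat.eq_zero_or_pos (Fintype.card ι) with hι | hι
  · rw [hN, hι]
    have : 0 ≤ Real.log (Fintype.card τ) := Real.log_natCast_nonneg _
    push_cast
    linarith
  set L : ℝ := Real.log (Fintype.card τ) with hL
  have hL0 : 0 ≤ L := Real.log_natCast_nonneg _
  have hτ : (Fintype.card τ : ℝ) ≤ Real.exp L := by
    rcases Nat.eq_zero_or_pos (Fintype.card τ) with h | h
    · rw [h]; simpa using (Real.exp_pos L).le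
    · rw [hL, Real.exp_log (by exact_mod_cast h)]
  -- The end of the proof gives `N ≤ 24 * (s + 1) / lam`; with this value the term `N * (lam ^ 2 /
  -- 2)` of `s` contributes exactly `N / 2`, which the left side absorbs.
  set lam : ℝ := 1 / 24 with hlam
  set s : ℝ := L + N * (lam ^ 2 / 2) with hs
  have hs0 : 0 ≤ s := by positivity
  have hsexp : Fintype.card τ * Real.exp (N * (lam ^ 2 / 2)) ≤ Real.exp s := by
    rw [hs, Real.exp_add]
    exact mul_le_mul_of_nonneg_right hτ (Real.exp_pos _).le
  have hA := sum_fixedSum_sub_mul_le f g hf0 hf1 hg0 hg1 hfg (by norm_num : 0 < lam) hs0 hsexp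
  have hB := sum_fixedSum_sub_mul_le g f hg0 hg1 hf0 hf1
    (fun x y => by simpa [mul_comm] using hfg y x) (by norm_num : 0 < lam) hs0 hsexp
  -- Complementing `d` exchanges the players, which brings the second estimate into the same
  -- variables as the first.
  let neg : Equiv.Perm (ι → Bool) := Function.Involutive.toPerm (fun d j => !d j) (fun d => by simp)
  rw [← Equiv.sum_comp neg] at hB
  have hneg : ∀ d, neg d = fun j => !d j := fun d => rfl
  simp only [hneg, Bool.not_not] at hB
  let rej : Bool → ι → (ι → Bool) → (ι → Bool) → (ι → Bool) → ℝ := fun c i d z w =>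
    if accept (HardSample.fst (c, i, d, z, w)) (HardSample.snd (c, i, d, z, w)) then 0 else 1
  have hprod : ∀ c i d, ∑ z, ∑ w, rej c i d z w =
      ∑ t, fixedSum (f t) i c d * fixedSum (g t) i c (fun j => !d j) := by
    intro c i d
    simp_rw [fixedSum, Finset.sum_mul_sum]
    rw [Finset.sum_comm (s := (Finset.univ : Finset τ))]
    refine Finset.sum_congr rfl fun z _ => ?_
    rw [Finset.sum_comm]
    refine Finset.sum_congr rfl fun w _ => ?_
    exact (hsum _ _).symm
  have hdiff : ∑ d : ι → Bool, ∑ i, (∑ z, ∑ w, rej false i d z w - ∑ z, ∑ w, rej true i d z w) ≤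
      K ^ 3 * (8 * (s + 1) / lam) := by
    calc _ ≤ ∑ d : ι → Bool, ∑ i, ∑ t,
          (max (fixedSum (f t) i false d - fixedSum (f t) i true d) 0 *
            fixedSum (g t) i false (fun j => !d j) +
          max (fixedSum (g t) i false (fun j => !d j) - fixedSum (g t) i true (fun j => !d j)) 0 *
            fixedSum (f t) i false d) := by
          refine Finset.sum_le_sum fun d _ => Finset.sum_le_sum fun i _ => ?_
          rw [hprod, hprod, ← Finset.sum_sub_distrib]
          exact Finset.sum_le_sum fun t _ => mul_sub_mul_le_max
            (fixedSum_nonneg (hf0 t) _ _ _)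
            (fixedSum_nonneg (hg0 t) _ _ _) (fixedSum_nonneg (hg0 t) _ _ _)
      _ ≤ _ := by
          simp_rw [Finset.sum_add_distrib]
          rw [show K ^ 3 * (8 * (s + 1) / lam) =
            K ^ 3 * (4 * (s + 1) / lam) + K ^ 3 * (4 * (s + 1) / lam) by ring]
          exact add_le_add hA hB
  have hcube : (Fintype.card (ι → Bool) : ℝ) = K := by simp [hK]
  have herr' : 3 * ∑ j : HardSample ι,
      (if ¬ (accept j.fst j.snd ↔ ∃ i, j.fst i = true ∧ j.snd i = true) then (1 : ℝ) else 0) ≤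
        2 * N * K ^ 3 := by
    rw [← Finset.sum_filter, Finset.sum_const, nsmul_eq_mul, mul_one]
    have e : (Fintype.card (HardSample ι) : ℝ) = 2 * N * K ^ 3 := by
      simp only [Fintype.card_prod, Nat.cast_mul, hcube, Fintype.card_bool]
      push_cast
      ring
    rw [← e]
    exact_mod_cast herr
  -- Errors are rejections with the forced bit `true` and acceptances with it `false`; the latter
  -- are all samples minus rejections.
  have hconv : ∑ j : HardSample ι,
      (if ¬ (accept j.fst j.snd ↔ ∃ i, j.fst i = true ∧ j.snd i = true) then (1 : ℝ) else 0) =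
      N * K ^ 3 - ∑ d : ι → Bool, ∑ i,
        (∑ z, ∑ w, rej false i d z w - ∑ z, ∑ w, rej true i d z w) := by
    have e1 : N * K ^ 3 = ∑ _d : ι → Bool, ∑ _i : ι, ∑ _z : ι → Bool, ∑ _w : ι → Bool, (1 : ℝ) := by
      simp only [Finset.sum_const, nsmul_eq_mul, mul_one, Finset.card_univ, hcube]
      ring
    rw [e1, Fintype.sum_prod_type, Fintype.sum_bool]
    simp_rw [HardSample.intersects_iff, Fintype.sum_prod_type]
    rw [Finset.sum_comm (s := (Finset.univ : Finset ι)),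
      Finset.sum_comm (s := (Finset.univ : Finset ι)), ← Finset.sum_add_distrib,
      ← Finset.sum_sub_distrib]
    refine Finset.sum_congr rfl fun d _ => ?_
    rw [← Finset.sum_add_distrib, ← Finset.sum_sub_distrib]
    refine Finset.sum_congr rfl fun i _ => ?_
    rw [← Finset.sum_sub_distrib, ← Finset.sum_sub_distrib, ← Finset.sum_add_distrib]
    refine Finset.sum_congr rfl fun z _ => ?_
    rw [← Finset.sum_sub_distrib, ← Finset.sum_sub_distrib, ← Finset.sum_add_distrib]
    refine Finset.sum_congr rfl fun w _ => ?_
    simp only [rej]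
    by_cases h1 : accept (HardSample.fst (true, i, d, z, w)) (HardSample.snd (true, i, d, z, w)) <;>
    by_cases h2 : accept (HardSample.fst (false, i, d, z, w))
      (HardSample.snd (false, i, d, z, w)) <;> simp [h1, h2]
  rw [hconv] at herr'
  have hfin : N * K ^ 3 ≤ 3 * (8 * (s + 1) / lam) * K ^ 3 := by linarith
  have hfin' := le_of_mul_le_mul_right hfin (by positivity)
  rw [hs, hlam] at hfin'
  norm_num at hfin'
  linarith

end Disjointness

/-! ## Two-party simulation -/

/-- The exact number is `2 ^ (b + 1) - 1`; the bound `4 ^ b` is coarser but tight at `b = 0`, where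
only silence is possible. -/
theorem card_message_le (b : ℕ) : Finite (Message b) ∧ Nat.card (Message b) ≤ 4 ^ b := by
  induction b with
  | zero =>
    have : Subsingleton (Message 0) := by
      refine ⟨fun a c => Subtype.ext ?_⟩
      have ha := List.length_eq_zero_iff.1 (Nat.le_zero.1 a.2)
      have hc := List.length_eq_zero_iff.1 (Nat.le_zero.1 c.2)
      rw [ha, hc]
    exact ⟨inferInstance, by simp⟩
  | succ b ih =>
    obtain ⟨hfin, hcard⟩ := ih
    let code : Message (b + 1) → Option (Bool × Message b) := fun l =>
      match l with
      | ⟨[], _⟩ => none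
      | ⟨a :: l, h⟩ => some (a, ⟨l, by simpa using h⟩)
    have hcode : Function.Injective code := by
      rintro ⟨l, h⟩ ⟨l', h'⟩ e
      cases l <;> cases l' <;> simp_all [code]
    refine ⟨Finite.of_injective code hcode, (Nat.card_le_card_of_injective code hcode).trans ?_⟩
    rw [Finite.card_option, Nat.card_prod, Nat.card_eq_fintype_card (α := Bool), Fintype.card_bool,
      pow_succ]
    have := Nat.one_le_pow b 4 (by norm_num)
    omega

/-- The two-party simulation of a CONGEST algorithm. The networks `G x y` have a common vertex
partition such that edges at the first side depend only on `x`, those at the second side only on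
`y`, and every crossing edge is among the listed ones. Then the rejected inputs form a
disjoint union of few combinatorial rectangles. -/
theorem CongestAlgorithm.exists_rectangles {n b : ℕ} (A : CongestAlgorithm n b) (T : ℕ)
    {X Y δ : Type} [Fintype δ] (G : X → Y → SimpleGraph (Fin n)) (side : Fin n → Prop)
    (src dst : δ → Fin n)
    (hX : ∀ x y y' v u, side v → ((G x y).Adj v u ↔ (G x y').Adj v u))
    (hY : ∀ x x' y v u, ¬ side v → ((G x y).Adj v u ↔ (G x' y).Adj v u))
    (hcut : ∀ x y v u, (G x y).Adj v u → (side v ↔ ¬ side u) → ∃ d, src d = v ∧ dst d = u) :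
    ∃ (τ : Type) (_ : Fintype τ) (S : τ → X → Prop) (U : τ → Y → Prop),
      Fintype.card τ ≤ (4 ^ b) ^ (T * Fintype.card δ) ∧
      (∀ x y, ¬ A.Accepts T (G x y) ↔ ∃ t, S t x ∧ U t y) ∧
      (∀ x y t t', S t x → U t y → S t' x → U t' y → t = t') := by
  classical
  have hfin := (card_message_le b).1
  let st : X → Y → ℕ → Fin n → A.State := fun x y => A.stateAfter (G x y)
  let tr : X → Y → Fin T × δ → Message b := fun x y p =>
    A.send (st x y p.1 (src p.2)) (dst p.2)
  -- Cut and paste: with equal transcripts, the mixed run on `(x, y')` looks like `(x, y)` on the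
  -- first side and like `(x', y')` on the second. Messages within a side agree by induction, those
  -- across it by the transcript.
  have key : ∀ x y x' y', tr x y = tr x' y' → ∀ t, t ≤ T →
      (∀ v, side v → st x y' t v = st x y t v) ∧
      (∀ v, ¬ side v → st x y' t v = st x' y' t v) := by
    intro x y x' y' h t
    induction t with
    | zero =>
      intro _
      constructor
      · intro v hv
        have : (G x y').neighborSet v = (G x y).neighborSet v := by
          ext u; exact hX x y' y v u hv
        simp only [st, CongestAlgorithm.stateAfter, this]
      · intro v hv
        have : (G x y').neighborSet v = (G x' y').neighborSet v := by
          ext u; exact hY x x' y' v u hv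
        simp only [st, CongestAlgorithm.stateAfter, this]
    | succ t ih =>
      intro ht
      obtain ⟨ih1, ih2⟩ := ih (by omega)
      have hmsg : ∀ d, A.send (st x y t (src d)) (dst d) = A.send (st x' y' t (src d)) (dst d) :=
        fun d => congrFun h (⟨t, by omega⟩, d)
      constructor
      · intro v hv
        simp only [st, CongestAlgorithm.stateAfter]
        congr 1
        · exact ih1 v hv
        · funext u
          by_cases hadj : (G x y').Adj v u
          · have hadj' := (hX x y' y v u hv).1 hadj
            rw [if_pos hadj, if_pos hadj']
            by_cases hu : side u
            · exact congrArg (fun s => some (A.send s v)) (ih1 u hu)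
            · obtain ⟨d, rfl, rfl⟩ := hcut x y' u v hadj.symm (by tauto)
              exact congrArg some ((congrArg (fun s => A.send s _) (ih2 _ hu)).trans (hmsg d).symm)
          · have hadj' := fun h' => hadj ((hX x y' y v u hv).2 h')
            rw [if_neg hadj, if_neg hadj']
      · intro v hv
        simp only [st, CongestAlgorithm.stateAfter]
        congr 1
        · exact ih2 v hv
        · funext u
          by_cases hadj : (G x y').Adj v u
          · have hadj' := (hY x x' y' v u hv).1 hadj
            rw [if_pos hadj, if_pos hadj']
            by_cases hu : side u
            · obtain ⟨d, rfl, rfl⟩ := hcut x y' u v hadj.symm (by tauto)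
              exact congrArg some ((congrArg (fun s => A.send s _) (ih1 _ hu)).trans (hmsg d))
            · exact congrArg (fun s => some (A.send s v)) (ih2 u hu)
          · have hadj' := fun h' => hadj ((hY x x' y' v u hv).2 h')
            rw [if_neg hadj, if_neg hadj']
  -- The transcript `m` is consistent with `x` for some input of the other player, and no node on
  -- this side accepts.
  let S : (Fin T × δ → Message b) → X → Prop := fun m x =>
    ∃ y, tr x y = m ∧ ∀ v, side v → A.output (st x y T v) = false
  let U : (Fin T × δ → Message b) → Y → Prop := fun m y =>
    ∃ x, tr x y = m ∧ ∀ v, ¬ side v → A.output (st x y T v) = false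
  have hSU : ∀ x y m, S m x → U m y → tr x y = m ∧ ¬ A.Accepts T (G x y) := by
    rintro x y' m ⟨y, h1, h2⟩ ⟨x', h3, h4⟩
    have hk := key x y x' y' (h1.trans h3.symm)
    constructor
    · rw [← h1]
      funext ⟨t, d⟩
      obtain ⟨k1, k2⟩ := hk t t.2.le
      by_cases hs : side (src d)
      · exact congrArg (fun s => A.send s (dst d)) (k1 _ hs)
      · refine (congrArg (fun s => A.send s (dst d)) (k2 _ hs)).trans ?_
        exact congrFun (h3.trans h1.symm) (t, d)
    · rintro ⟨v, hv⟩
      obtain ⟨k1, k2⟩ := hk T le_rfl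
      by_cases hs : side v
      · have := h2 v hs
        rw [← k1 v hs] at this
        exact Bool.false_ne_true (this.symm.trans hv)
      · have := h4 v hs
        rw [← k2 v hs] at this
        exact Bool.false_ne_true (this.symm.trans hv)
  let _ := Fintype.ofFinite (Fin T × δ → Message b)
  refine ⟨Fin T × δ → Message b, inferInstance, S, U, ?_, ?_, ?_⟩
  · rw [← Nat.card_eq_fintype_card, Nat.card_fun, Nat.card_eq_fintype_card (α := Fin T × δ),
      Fintype.card_prod, Fintype.card_fin]
    exact Nat.pow_le_pow_left (card_message_le b).2 _
  · intro x y
    constructor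
    · intro h
      have h' : ∀ v, A.output (st x y T v) = false := fun v => by
        by_contra hv
        exact h ⟨v, by simpa using hv⟩
      exact ⟨tr x y, ⟨y, rfl, fun v _ => h' v⟩, ⟨x, rfl, fun v _ => h' v⟩⟩
    · rintro ⟨m, h1, h2⟩
      exact (hSU x y m h1 h2).2
  · intro x y m m' h1 h2 h3 h4
    rw [← (hSU x y m h1 h2).1, (hSU x y m' h3 h4).1]

/-! ## Treewidth -/

/-- Iterate the parent map until `t`; the rank makes it stop. This gives connectivity of the tree
(`P` trivial) as well as connectivity of the bags containing a vertex. -/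
theorem exists_walk_of_parent {V : Type*} {G : SimpleGraph V} (r : V) (ρ : V → ℕ) (f : V → V)
    (hρ : ∀ v, v ≠ r → ρ (f v) < ρ v) (hG : ∀ v, v ≠ r → G.Adj v (f v)) (P : V → Prop) (t : V)
    (hP : ∀ v, P v → v ≠ t → v ≠ r ∧ P (f v)) (v : V) (hv : P v) :
    ∃ p : G.Walk v t, ∀ j ∈ p.support, P j := by
  induction hn : ρ v using Nat.strong_induction_on generalizing v with
  | _ n ih =>
    by_cases h : v = t
    · subst h
      exact ⟨.nil, by simpa using hv⟩
    · obtain ⟨hr, hf⟩ := hP v hv h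
      obtain ⟨p, hp⟩ := ih _ (hn ▸ hρ v hr) (f v) hf rfl
      refine ⟨.cons (hG v hr) p, ?_⟩
      intro j hj
      rw [SimpleGraph.Walk.support_cons, List.mem_cons] at hj
      rcases hj with rfl | hj
      exacts [hv, hp j hj]

/-- The tree in which each node other than the root `r` is joined to its parent. -/
def parentTree {V : Type*} (r : V) (f : V → V) : SimpleGraph V :=
  SimpleGraph.fromRel fun u v => u ≠ r ∧ v = f u

theorem parentTree_isTree {V : Type*} [Finite V] (r : V) (ρ : V → ℕ) (f : V → V)
    (hρ : ∀ v, v ≠ r → ρ (f v) < ρ v) : (parentTree r f).IsTree := by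
  classical
  have hne : ∀ v, v ≠ r → v ≠ f v := fun v hv h => by
    have := hρ v hv
    rw [← h] at this
    exact lt_irrefl _ this
  have hG : ∀ v, v ≠ r → (parentTree r f).Adj v (f v) := fun v hv =>
    (SimpleGraph.fromRel_adj _ _ _).2 ⟨hne v hv, Or.inl ⟨hv, rfl⟩⟩
  have hreach : ∀ v, (parentTree r f).Reachable v r := fun v => by
    obtain ⟨p, _⟩ := exists_walk_of_parent r ρ f hρ hG (fun _ => True) r
      (fun v _ hv => ⟨hv, trivial⟩) v trivial
    exact ⟨p⟩
  have hconn : (parentTree r f).Connected :=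
    (SimpleGraph.connected_iff _).2 ⟨fun u v => (hreach u).trans (hreach v).symm, ⟨r⟩⟩
  refine SimpleGraph.isTree_iff_connected_and_card.2 ⟨hconn, ?_⟩
  refine le_antisymm ?_ hconn.card_vert_le_card_edgeSet_add_one
  -- Every edge joins a non-root to its parent, so a connected graph has too few edges for a cycle.
  have hsurj : Function.Surjective
      (fun v : {v // v ≠ r} => (⟨s(v.1, f v.1), hG v.1 v.2⟩ : (parentTree r f).edgeSet)) := by
    rintro ⟨e, he⟩
    induction e with
    | _ u v =>
      obtain ⟨_, ⟨hu, rfl⟩ | ⟨hv, rfl⟩⟩ : u ≠ v ∧ ((u ≠ r ∧ v = f u) ∨ (v ≠ r ∧ u = f v)) := he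
      · exact ⟨⟨u, hu⟩, rfl⟩
      · exact ⟨⟨v, hv⟩, Subtype.ext Sym2.eq_swap⟩
  have hcard : Nat.card (parentTree r f).edgeSet ≤ Nat.card {v // v ≠ r} :=
    Nat.card_le_card_of_surjective _ hsurj
  have : Nat.card {v // v ≠ r} + 1 = Nat.card V := by
    have := Fintype.ofFinite V
    rw [Nat.card_eq_fintype_card, Nat.card_eq_fintype_card, Fintype.card_subtype_compl,
      Fintype.card_subtype_eq]
    have : 0 < Fintype.card V := Fintype.card_pos_iff.2 ⟨r⟩
    omega
  omega

/-- An elimination order in which every vertex has at most two later neighbours, contained in a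
later triangle. -/
theorem exists_treeDecomposition_of_elimination {V : Type*} [Fintype V] (G : SimpleGraph V)
    (r : V) (ρ : V → ℕ) (f g : V → V) (hρ : ∀ v, v ≠ r → ρ (f v) < ρ v) (hfr : f r = r)
    (hgr : g r = r)
    (hg : ∀ v, v ≠ r → g v = f v ∨ g v = f (f v) ∨ g v = g (f v))
    (hadj : ∀ u v, G.Adj u v → v = f u ∨ v = g u ∨ u = f v ∨ u = g v) :
    ∃ D : TreeDecomposition G, D.width ≤ 2 := by
  classical
  let e : V ≃ Fin (Fintype.card V) := Fintype.equivFin V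
  let f' : Fin (Fintype.card V) → Fin (Fintype.card V) := fun i => e (f (e.symm i))
  let ρ' : Fin (Fintype.card V) → ℕ := fun i => ρ (e.symm i)
  let bag : Fin (Fintype.card V) → Finset V := fun i =>
    {e.symm i, f (e.symm i), g (e.symm i)}
  have hbag : ∀ v u, u ∈ bag (e v) ↔ u = v ∨ u = f v ∨ u = g v := by
    intro v u; simp [bag]
  have hρ' : ∀ i, i ≠ e r → ρ' (f' i) < ρ' i := by
    intro i hi
    simp only [ρ', f', Equiv.symm_apply_apply]
    exact hρ _ fun h => hi (by rw [← h, Equiv.apply_symm_apply])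
  have htree := parentTree_isTree (e r) ρ' f' hρ'
  have hG : ∀ v, v ≠ e r → (parentTree (e r) f').Adj v (f' v) := fun v hv => by
    refine (SimpleGraph.fromRel_adj _ _ _).2 ⟨fun h => ?_, Or.inl ⟨hv, rfl⟩⟩
    have := hρ' v hv
    rw [← h] at this
    exact lt_irrefl _ this
  -- The bags containing `v` form a subtree with top `e v`: by `hg`, what remains of a bag after
  -- removing its own vertex lies in the parent's bag.
  have hstep : ∀ v i, v ∈ bag i → i ≠ e v → i ≠ e r ∧ v ∈ bag (f' i) := by
    intro v i
    obtain ⟨u, rfl⟩ := e.surjective i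
    have : f' (e u) = e (f u) := by simp [f']
    rw [this, hbag, hbag]
    intro h1 h2
    have huv : u ≠ v := fun h => h2 (h ▸ rfl)
    have hur : u ≠ r := by
      rintro rfl
      rw [hfr, hgr] at h1
      rcases h1 with h | h | h <;> exact huv h.symm
    refine ⟨fun h => hur (e.injective h), ?_⟩
    rcases h1 with h | h | h
    · exact absurd h.symm huv
    · exact Or.inl h
    · rw [h]
      exact hg u hur
  refine ⟨⟨Fintype.card V, parentTree (e r) f', bag, htree, ?_, ?_, ?_⟩, ?_⟩
  · exact fun v => ⟨e v, (hbag v v).2 (Or.inl rfl)⟩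
  · intro u v huv
    rcases hadj u v huv with h | h | h | h
    · exact ⟨e u, (hbag u u).2 (Or.inl rfl), (hbag u v).2 (Or.inr (Or.inl h))⟩
    · exact ⟨e u, (hbag u u).2 (Or.inl rfl), (hbag u v).2 (Or.inr (Or.inr h))⟩
    · exact ⟨e v, (hbag v u).2 (Or.inr (Or.inl h)), (hbag v v).2 (Or.inl rfl)⟩
    · exact ⟨e v, (hbag v u).2 (Or.inr (Or.inr h)), (hbag v v).2 (Or.inl rfl)⟩
  · intro i j l p hp hj v hi hl
    obtain ⟨q, hq⟩ := exists_walk_of_parent (e r) ρ' f' hρ' hG (fun i => v ∈ bag i) (e v)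
      (hstep v) i hi
    obtain ⟨q', hq'⟩ := exists_walk_of_parent (e r) ρ' f' hρ' hG (fun i => v ∈ bag i) (e v)
      (hstep v) l hl
    -- Paths in a tree are unique, so `p` is the shortcut of the walk through `e v`, all of whose
    -- bags contain `v`.
    have : p = (q.append q'.reverse).bypass :=
      congrArg Subtype.val ((htree.isAcyclic.subsingleton_path i l).elim ⟨p, hp⟩
        ⟨_, (q.append q'.reverse).bypass_isPath⟩)
    rw [this] at hj
    have hj' := (q.append q'.reverse).support_bypass_subset_support hj
    rw [SimpleGraph.Walk.mem_support_append_iff, SimpleGraph.Walk.support_reverse,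
      List.mem_reverse] at hj'
    exact hj'.elim (hq j) (hq' j)
  · refine Nat.sub_le_iff_le_add.2 (Finset.sup_le fun i _ => ?_)
    exact Finset.card_le_three

/-! ### Triangles force width at least 2. -/

/-- Three pairwise intersecting subtrees of a tree have a common vertex. -/
theorem TreeDecomposition.exists_bag_of_triangle {V : Type*} {G : SimpleGraph V}
    (D : TreeDecomposition G) {a b c : V} (hab : G.Adj a b) (hbc : G.Adj b c) (hac : G.Adj a c) :
    ∃ m, a ∈ D.bag m ∧ b ∈ D.bag m ∧ c ∈ D.bag m := by
  classical
  obtain ⟨i, hia, hib⟩ := D.cover_edge a b hab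
  obtain ⟨j, hjb, hjc⟩ := D.cover_edge b c hbc
  obtain ⟨l, hla, hlc⟩ := D.cover_edge a c hac
  -- The vertex sought is the last one on the path to `j` whose bag contains `a`. From `l` one
  -- reaches it through bags containing `a`, and the rest of the path avoids those, so the
  -- concatenation is a path.
  have key : ∀ (u : Fin D.size) (p : D.tree.Walk u j), p.IsPath → a ∈ D.bag u →
      ∃ m ∈ p.support, a ∈ D.bag m ∧ ∃ q : D.tree.Walk l j, q.IsPath ∧ m ∈ q.support := by
    have hbase : ∀ (u : Fin D.size) (p : D.tree.Walk u j), p.IsPath → a ∈ D.bag u →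
        (∀ w ∈ p.support, w ≠ u → a ∉ D.bag w) →
        ∃ m ∈ p.support, a ∈ D.bag m ∧ ∃ q : D.tree.Walk l j, q.IsPath ∧ m ∈ q.support := by
      intro u p hp hu hno
      obtain ⟨q⟩ := D.isTree.connected.preconnected l u
      have hq := q.bypass_isPath
      refine ⟨u, p.start_mem_support, hu, q.bypass.append p, ?_, ?_⟩
      · rw [SimpleGraph.Walk.isPath_def, SimpleGraph.Walk.support_append, List.nodup_append']
        refine ⟨hq.support_nodup, hp.support_nodup.tail, ?_⟩
        intro w hw hw'
        have hwa := D.path_inter l w u _ hq hw a hla hu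
        refine hno w (List.mem_of_mem_tail hw') ?_ hwa
        rintro rfl
        have := hp.support_nodup
        rw [← SimpleGraph.Walk.cons_tail_support, List.nodup_cons] at this
        exact this.1 hw'
      · rw [SimpleGraph.Walk.mem_support_append_iff]
        exact Or.inr p.start_mem_support
    intro u p
    induction p with
    | nil =>
      intro hp hu
      exact hbase _ _ hp hu fun w hw hne => absurd (by simpa using hw) hne
    | cons h p ih =>
      rename_i u v j'
      intro hp hu
      by_cases hex : ∃ w ∈ (SimpleGraph.Walk.cons h p).support, w ≠ u ∧ a ∈ D.bag w
      · obtain ⟨w, hw, hwu, hwa⟩ := hex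
        have hw' : w ∈ p.support := by
          rw [SimpleGraph.Walk.support_cons, List.mem_cons] at hw
          exact hw.resolve_left hwu
        have hp' := (SimpleGraph.Walk.cons_isPath_iff h p).1 hp
        have hpath : (SimpleGraph.Walk.cons h (p.takeUntil w hw')).IsPath :=
          (SimpleGraph.Walk.cons_isPath_iff _ _).2 ⟨hp'.1.takeUntil hw', fun hu' =>
            hp'.2 (p.support_takeUntil_subset_support hw' hu')⟩
        have hv : a ∈ D.bag v := D.path_inter u v w _ hpath
          (by rw [SimpleGraph.Walk.support_cons]
              exact List.mem_cons_of_mem _ (SimpleGraph.Walk.start_mem_support _)) a hu hwa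
        obtain ⟨m, hm, h1, h2⟩ := ih hjb hjc hbase hp'.1 hv
        refine ⟨m, ?_, h1, h2⟩
        rw [SimpleGraph.Walk.support_cons]
        exact List.mem_cons_of_mem _ hm
      · push Not at hex
        exact hbase _ _ hp hu fun w hw hne => hex w hw hne
  obtain ⟨p⟩ := D.isTree.connected.preconnected i j
  obtain ⟨m, hm, hma, q, hq, hmq⟩ := key i p.bypass p.bypass_isPath hia
  exact ⟨m, hma, D.path_inter i m j _ p.bypass_isPath hm b hib hjb,
    D.path_inter l m j q hq hmq c hlc hjc⟩

theorem TreeDecomposition.two_le_width_of_triangle {V : Type*} {G : SimpleGraph V}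
    (D : TreeDecomposition G) {a b c : V} (hab : G.Adj a b) (hbc : G.Adj b c) (hac : G.Adj a c) :
    2 ≤ D.width := by
  classical
  obtain ⟨m, ha, hb, hc⟩ := D.exists_bag_of_triangle hab hbc hac
  have h3 : 3 ≤ (D.bag m).card := by
    rw [← Finset.card_eq_three.2 ⟨a, b, c, hab.ne, hac.ne, hbc.ne, rfl⟩]
    refine Finset.card_le_card fun v hv => ?_
    simp only [Finset.mem_insert, Finset.mem_singleton] at hv
    rcases hv with rfl | rfl | rfl <;> assumption
  have := Finset.le_sup (f := fun i => (D.bag i).card) (Finset.mem_univ m)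
  unfold TreeDecomposition.width
  omega

theorem treewidth_eq_two {V : Type*} {G : SimpleGraph V} {a b c : V} (hab : G.Adj a b)
    (hbc : G.Adj b c) (hac : G.Adj a c) (D : TreeDecomposition G) (hD : D.width ≤ 2) :
    treewidth G = 2 := by
  refine le_antisymm ((Nat.sInf_le
    (show D.width ∈ {w | ∃ D : TreeDecomposition G, D.width = w} from ⟨D, rfl⟩)).trans hD) (le_csInf
    (show Set.Nonempty {w | ∃ D : TreeDecomposition G, D.width = w} from ⟨_, D, rfl⟩) ?_)
  rintro w ⟨D', rfl⟩
  exact D'.two_le_width_of_triangle hab hbc hac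

/-- Transport of a tree decomposition along an isomorphism. -/
def TreeDecomposition.congr {V W : Type*} {G : SimpleGraph V} {H : SimpleGraph W} (e : G ≃g H)
    (D : TreeDecomposition G) : TreeDecomposition H where
  size := D.size
  tree := D.tree
  bag i := (D.bag i).map e.toEquiv.toEmbedding
  isTree := D.isTree
  cover_vertex v := by
    obtain ⟨i, hi⟩ := D.cover_vertex (e.symm v)
    exact ⟨i, Finset.mem_map.2 ⟨_, hi, e.apply_symm_apply v⟩⟩
  cover_edge u v h := by
    obtain ⟨i, hu, hv⟩ := D.cover_edge (e.symm u) (e.symm v) (e.symm.map_adj_iff.2 h)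
    exact ⟨i, Finset.mem_map.2 ⟨_, hu, e.apply_symm_apply u⟩,
      Finset.mem_map.2 ⟨_, hv, e.apply_symm_apply v⟩⟩
  path_inter i j l p hp hj v hi hl := by
    obtain ⟨u, hu, rfl⟩ := Finset.mem_map.1 hi
    obtain ⟨u', hu', h⟩ := Finset.mem_map.1 hl
    obtain rfl := e.toEquiv.toEmbedding.injective h
    exact Finset.mem_map_of_mem _ (D.path_inter i j l p hp hj _ hu hu')

theorem TreeDecomposition.width_congr {V W : Type*} {G : SimpleGraph V} {H : SimpleGraph W}
    (e : G ≃g H) (D : TreeDecomposition G) : (D.congr e).width = D.width := by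
  simp only [TreeDecomposition.width, TreeDecomposition.congr, Finset.card_map]
  rfl

theorem treewidth_congr {V W : Type*} {G : SimpleGraph V} {H : SimpleGraph W} (e : G ≃g H) :
    treewidth G = treewidth H := by
  unfold treewidth
  congr 1
  ext w
  constructor
  · rintro ⟨D, rfl⟩
    exact ⟨D.congr e, D.width_congr e⟩
  · rintro ⟨D, rfl⟩
    exact ⟨D.congr e.symm, D.width_congr e.symm⟩

/-! ### The elimination order: the triangle nodes labelled 1 and 2 form an eight-cycle once each
bundle of paths is replaced by an edge; it is triangulated as a fan at `(0, 0, 1)`, and each path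
and each third node hangs on an edge of the result. Higher ranks are eliminated first. -/

/-- The rank of a triangle vertex in an elimination order of the pattern graph. -/
def triangleRank : Fin 2 × Fin 2 × Fin 3 → ℕ
  | (0, 0, 1) => 0
  | (1, 0, 1) => 1
  | (1, 0, 0) => 2
  | (1, 1, 0) => 3
  | (1, 1, 1) => 4
  | (0, 1, 1) => 5
  | (0, 1, 0) => 6
  | (0, 0, 0) => 7
  | _ => 8

/-- The first later neighbour of a triangle vertex in the triangulated pattern graph. -/
def triangleParent : Fin 2 × Fin 2 × Fin 3 → Fin 2 × Fin 2 × Fin 3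
  | (0, 0, 1) => (0, 0, 1)
  | (1, 0, 1) => (0, 0, 1)
  | (1, 0, 0) => (1, 0, 1)
  | (1, 1, 0) => (1, 0, 0)
  | (1, 1, 1) => (1, 1, 0)
  | (0, 1, 1) => (1, 1, 1)
  | (0, 1, 0) => (0, 1, 1)
  | (0, 0, 0) => (0, 1, 0)
  | (1, 1, 2) => (1, 1, 1)
  | (s, i, _) => (s, i, 0)

/-- The second later neighbour of a triangle vertex in the triangulated pattern graph. -/
def triangleParent' : Fin 2 × Fin 2 × Fin 3 → Fin 2 × Fin 2 × Fin 3
  | (1, 1, 2) => (1, 1, 0)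
  | (s, i, 2) => (s, i, 1)
  | _ => (0, 0, 1)

/-- The rank of a vertex in an elimination order of the pattern graph. -/
def patternRank (k : ℕ) : PatternVertex k → ℕ
  | .inl a => triangleRank a
  | .inr (_, _, q) => 9 + q

/-- The first later neighbour in the triangulated pattern graph. -/
def patternParent (k : ℕ) : PatternVertex k → PatternVertex k
  | .inl a => .inl (triangleParent a)
  | .inr (i, p, q) =>
      if q = 0 then (if i = 0 then .inl (1, 0, 1) else .inl (0, 1, 1)) else .inr (i, p, q - 1)

/-- The second later neighbour in the triangulated pattern graph. -/
def patternParent' (k : ℕ) : PatternVertex k → PatternVertex k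
  | .inl a => .inl (triangleParent' a)
  | .inr (i, _, q) =>
      if i = 0 then (if q = 0 then .inl (0, 0, 1) else .inl (1, 0, 1)) else .inl (1, 1, 1)

theorem treewidth_patternGraph (k : ℕ) : treewidth (patternGraph k) = 2 := by
  have htri : ∀ s i l s' i' l',
      (s = s' ∧ i = i' ∧ l ≠ l') ∨ (s = s' ∧ i ≠ i' ∧ l = 0 ∧ l' = 0) →
      (s', i', l') = triangleParent (s, i, l) ∨ (s', i', l') = triangleParent' (s, i, l) ∨
      (s, i, l) = triangleParent (s', i', l') ∨ (s, i, l) = triangleParent' (s', i', l') := by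
    decide
  have hrel : ∀ u v, patternRel k u v → v = patternParent k u ∨ v = patternParent' k u ∨
      u = patternParent k v ∨ u = patternParent' k v := by
    rintro (⟨s, i, l⟩ | ⟨i, p, q⟩) (⟨s', i', l'⟩ | ⟨i', p', q'⟩) h
    · simpa only [patternParent, patternParent', Sum.inl.injEq] using htri s i l s' i' l' h
    · obtain ⟨rfl, rfl, ⟨rfl, rfl⟩ | ⟨rfl, rfl⟩⟩ := h <;> fin_cases i <;>
        simp [patternParent, patternParent']
    · exact h.elim
    · obtain ⟨rfl, rfl, h⟩ := h
      have h1 : q' ≠ 0 := by rintro rfl; simp at h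
      have h2 : q = q' - 1 := by
        fin_cases q' <;> fin_cases q <;> simp at h ⊢
      simp [patternParent, h1, h2]
  have hadj : ∀ u v, (patternGraph k).Adj u v → v = patternParent k u ∨ v = patternParent' k u ∨
      u = patternParent k v ∨ u = patternParent' k v := by
    intro u v h
    rcases ((SimpleGraph.fromRel_adj _ _ _).1 h).2 with h | h
    · exact hrel u v h
    · have := hrel v u h
      tauto
  have hrank : ∀ a, a ≠ (0, 0, 1) → triangleRank (triangleParent a) < triangleRank a := by
    decide
  have htri' : ∀ a, triangleParent' a = triangleParent a ∨
      triangleParent' a = triangleParent (triangleParent a) ∨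
      triangleParent' a = triangleParent' (triangleParent a) := by
    decide
  obtain ⟨D, hD⟩ := exists_treeDecomposition_of_elimination (patternGraph k) (.inl (0, 0, 1))
    (patternRank k) (patternParent k) (patternParent' k)
    (by
      rintro (a | ⟨i, p, q⟩) h
      · exact hrank a fun h' => h (congrArg _ h')
      · fin_cases i <;> fin_cases q <;> simp [patternParent, patternRank, triangleRank])
    rfl rfl
    (by
      rintro (a | ⟨i, p, q⟩) h
      · simpa only [patternParent, patternParent', Sum.inl.injEq] using htri' a
      · fin_cases i <;> fin_cases q <;>
          simp [patternParent, patternParent', triangleParent, triangleParent'])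
    hadj
  exact treewidth_eq_two (a := .inl (0, 0, 0)) (b := .inl (0, 0, 1)) (c := .inl (0, 0, 2))
    (by simp [patternGraph, patternRel]) (by simp [patternGraph, patternRel])
    (by simp [patternGraph, patternRel]) D hD

/-! ## The host graphs -/

/-- Vertices of the host graph. The indices are the words `w : Fin k → Fin r`. For each index and
each of the four triangles of the pattern there is a triangle, whose second node is
attached through `k` subdivision nodes to the hubs `(p, w p)`. -/
inductive HostVertex (k r : ℕ) : Type
  | tri (s i : Fin 2) (w : Fin k → Fin r) (l : Fin 3)
  | sub (s i : Fin 2) (w : Fin k → Fin r) (p : Fin k)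
  | hub (s i : Fin 2) (p : Fin k) (a : Fin r)

namespace HostVertex

/-- The side of a host vertex. -/
def side {k r : ℕ} : HostVertex k r → Fin 2
  | tri s _ _ _ => s
  | sub s _ _ _ => s
  | hub s _ _ _ => s

/-- Host vertices as a sum of finite types. -/
def equivSum (k r : ℕ) : HostVertex k r ≃
    (Fin 2 × Fin 2 × (Fin k → Fin r) × Fin 3) ⊕ (Fin 2 × Fin 2 × (Fin k → Fin r) × Fin k) ⊕
      (Fin 2 × Fin 2 × Fin k × Fin r) where
  toFun
    | tri s i w l => .inl (s, i, w, l)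
    | sub s i w p => .inr (.inl (s, i, w, p))
    | hub s i p a => .inr (.inr (s, i, p, a))
  invFun
    | .inl (s, i, w, l) => tri s i w l
    | .inr (.inl (s, i, w, p)) => sub s i w p
    | .inr (.inr (s, i, p, a)) => hub s i p a
  left_inv := by rintro (_ | _ | _) <;> rfl
  right_inv := by rintro (_ | _ | _) <;> rfl

noncomputable instance (k r : ℕ) : Fintype (HostVertex k r) :=
  Fintype.ofEquiv _ (equivSum k r).symm

theorem card_le {k r : ℕ} (hk : 1 ≤ k) : Fintype.card (HostVertex k r) ≤ (12 + 8 * k) * r ^ k := by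
  rw [Fintype.card_congr (equivSum k r)]
  simp only [Fintype.card_sum, Fintype.card_prod, Fintype.card_fin, Fintype.card_fun]
  have : r ≤ r ^ k := Nat.le_self_pow (by omega) r
  nlinarith

end HostVertex

section HostGraphs

open HostVertex

/-- The edges of the host graph, each listed in at least one direction. -/
def hostRel {k r : ℕ} (x y : (Fin k → Fin r) → Bool) : HostVertex k r → HostVertex k r → Prop
  | tri s i w l, tri s' i' w' l' =>
      s = s' ∧ w = w' ∧ ((i = i' ∧ l ≠ l') ∨
        (i ≠ i' ∧ l = 0 ∧ l' = 0 ∧ (if s = 0 then x w else y w) = true))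
  | tri s i w l, sub s' i' w' _ => s = s' ∧ i = i' ∧ w = w' ∧ l = 1
  | sub s i w p, hub s' i' p' a => s = s' ∧ i = i' ∧ p = p' ∧ a = w p
  | hub s i p a, hub s' i' p' a' => s ≠ s' ∧ i = i' ∧ p = p' ∧ a = a'
  | _, _ => False

/-- The host graph: for each index in `x` the two triangles of that index on side `0` are joined by
an edge, and similarly for `y` and side `1`. -/
def hostGraph {k r : ℕ} (x y : (Fin k → Fin r) → Bool) : SimpleGraph (HostVertex k r) :=
  SimpleGraph.fromRel (hostRel x y)

section Adjacency

variable {k r : ℕ} {x y : (Fin k → Fin r) → Bool}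

theorem hostGraph_tri_tri {s i w l s' i' w' l'} :
    (hostGraph x y).Adj (tri s i w l) (tri s' i' w' l') ↔
      s = s' ∧ w = w' ∧ ((i = i' ∧ l ≠ l') ∨
        (i ≠ i' ∧ l = 0 ∧ l' = 0 ∧ (if s = 0 then x w else y w) = true)) := by
  simp only [hostGraph, SimpleGraph.fromRel_adj, hostRel]
  constructor
  · rintro ⟨_, h | ⟨rfl, rfl, ⟨rfl, h⟩ | ⟨h, rfl, rfl, h'⟩⟩⟩
    · exact h
    · exact ⟨rfl, rfl, Or.inl ⟨rfl, h.symm⟩⟩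
    · exact ⟨rfl, rfl, Or.inr ⟨h.symm, rfl, rfl, h'⟩⟩
  · intro h
    refine ⟨?_, Or.inl h⟩
    intro he
    injection he
    rcases h.2.2 with h | h
    · exact h.2 (by assumption)
    · exact h.1 (by assumption)

theorem hostGraph_tri_sub {s i w l s' i' w' p} :
    (hostGraph x y).Adj (tri s i w l) (sub s' i' w' p) ↔ s = s' ∧ i = i' ∧ w = w' ∧ l = 1 := by
  simp [hostGraph, hostRel]

theorem hostGraph_tri_hub {s i w l s' i' p a} :
    ¬ (hostGraph x y).Adj (tri s i w l) (hub s' i' p a) := by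
  simp [hostGraph, hostRel]

theorem hostGraph_sub_sub {s i w p s' i' w' p'} :
    ¬ (hostGraph x y).Adj (sub s i w p) (sub s' i' w' p') := by
  simp [hostGraph, hostRel]

theorem hostGraph_sub_hub {s i w p s' i' p' a} :
    (hostGraph x y).Adj (sub s i w p) (hub s' i' p' a) ↔ s = s' ∧ i = i' ∧ p = p' ∧ a = w p := by
  simp [hostGraph, hostRel]

theorem hostGraph_hub_hub {s i p a s' i' p' a'} :
    (hostGraph x y).Adj (hub s i p a) (hub s' i' p' a') ↔
      s ≠ s' ∧ i = i' ∧ p = p' ∧ a = a' := by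
  simp only [hostGraph, SimpleGraph.fromRel_adj, hostRel]
  constructor
  · rintro ⟨_, h | ⟨h, rfl, rfl, rfl⟩⟩
    · exact h
    · exact ⟨h.symm, rfl, rfl, rfl⟩
  · intro h
    refine ⟨?_, Or.inl h⟩
    intro he
    injection he
    exact h.1 (by assumption)

theorem hostGraph_sub_tri {s i w l s' i' w' p} :
    (hostGraph x y).Adj (sub s' i' w' p) (tri s i w l) ↔ s = s' ∧ i = i' ∧ w = w' ∧ l = 1 := by
  rw [SimpleGraph.adj_comm, hostGraph_tri_sub]

theorem hostGraph_hub_tri {s i w l s' i' p a} :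
    ¬ (hostGraph x y).Adj (hub s' i' p a) (tri s i w l) := by
  rw [SimpleGraph.adj_comm]; exact hostGraph_tri_hub

theorem hostGraph_hub_sub {s i w p s' i' p' a} :
    (hostGraph x y).Adj (hub s' i' p' a) (sub s i w p) ↔ s = s' ∧ i = i' ∧ p = p' ∧ a = w p := by
  rw [SimpleGraph.adj_comm, hostGraph_sub_hub]

end Adjacency

/-! ### Degeneracy -/

/-- In any vertex set, a vertex of least rank sees only neighbours of at least its own rank. -/
theorem isDegenerate_two_of_rank {V : Type*} (G : SimpleGraph V) (ρ : V → ℕ)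
    (h : ∀ v, ∃ a b, ∀ w, G.Adj v w → ρ v ≤ ρ w → w = a ∨ w = b) : IsDegenerate G 2 := by
  classical
  intro S hS
  obtain ⟨v, hv, hmin⟩ := S.exists_min_image ρ hS
  obtain ⟨a, b, hab⟩ := h v
  refine ⟨v, hv, ?_⟩
  refine (Finset.card_le_card (t := {a, b}) fun w hw => ?_).trans Finset.card_le_two
  rw [Finset.mem_filter] at hw
  simpa using hab w hw.2 (hmin w hw.1)

theorem degeneracy_eq_two {V : Type*} (G : SimpleGraph V) (h : IsDegenerate G 2) {a b c : V}
    (hab : G.Adj a b) (hbc : G.Adj b c) (hac : G.Adj a c) : degeneracy G = 2 := by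
  classical
  refine le_antisymm (Nat.sInf_le h) (le_csInf ⟨2, h⟩ ?_)
  intro d hd
  obtain ⟨v, hv, hcard⟩ := hd {a, b, c} ⟨a, by simp⟩
  refine le_trans ?_ hcard
  have key : ∀ u w, u ∈ ({a, b, c} : Finset V) → w ∈ ({a, b, c} : Finset V) → u ≠ w →
      G.Adj v u → G.Adj v w → 2 ≤ (({a, b, c} : Finset V).filter fun w => G.Adj v w).card := by
    intro u w hu hw hne h1 h2
    rw [← Finset.card_pair hne]
    refine Finset.card_le_card fun t ht => ?_
    rw [Finset.mem_insert, Finset.mem_singleton] at ht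
    rcases ht with rfl | rfl
    exacts [Finset.mem_filter.2 ⟨hu, h1⟩, Finset.mem_filter.2 ⟨hw, h2⟩]
  simp only [Finset.mem_insert, Finset.mem_singleton] at hv
  rcases hv with rfl | rfl | rfl
  · convert key b c (by simp) (by simp) hbc.ne hab hac
  · convert key a c (by simp) (by simp) hac.ne hab.symm hbc
  · convert key a b (by simp) (by simp) hab.ne hac.symm hbc.symm

/-- A degeneracy order of the host graph. -/
def hostRank {k r : ℕ} : HostVertex k r → ℕ
  | sub _ _ _ _ => 0
  | tri _ _ _ l => if l = 2 then 1 else if l = 1 then 2 else 3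
  | hub _ _ _ _ => 4

theorem hostGraph_rank {k r : ℕ} (x y : (Fin k → Fin r) → Bool) (v : HostVertex k r) :
    ∃ a b, ∀ u, (hostGraph x y).Adj v u → hostRank v ≤ hostRank u → u = a ∨ u = b := by
  rcases v with ⟨s, i, w, l⟩ | ⟨s, i, w, p⟩ | ⟨s, i, p, a⟩
  · have hl : l = 0 ∨ l = 1 ∨ l = 2 := by fin_cases l <;> simp
    rcases hl with rfl | rfl | rfl
    · refine ⟨tri s (i + 1) w 0, tri s (i + 1) w 0, ?_⟩
      rintro (⟨s', i', w', l'⟩ | ⟨s', i', w', p'⟩ | ⟨s', i', p', a'⟩) h hr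
      · obtain ⟨rfl, rfl, ⟨rfl, h⟩ | ⟨h, _, rfl, _⟩⟩ := hostGraph_tri_tri.1 h
        · fin_cases l' <;> simp [hostRank] at h hr
        · have : i' = i + 1 := by omega
          simp [this]
      · simp [hostRank] at hr
      · exact (hostGraph_tri_hub h).elim
    · refine ⟨tri s i w 0, tri s i w 0, ?_⟩
      rintro (⟨s', i', w', l'⟩ | ⟨s', i', w', p'⟩ | ⟨s', i', p', a'⟩) h hr
      · obtain ⟨rfl, rfl, ⟨rfl, h⟩ | ⟨_, h, _⟩⟩ := hostGraph_tri_tri.1 h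
        · fin_cases l' <;> simp [hostRank] at h hr ⊢
        · simp at h
      · simp [hostRank] at hr
      · exact (hostGraph_tri_hub h).elim
    · refine ⟨tri s i w 0, tri s i w 1, ?_⟩
      rintro (⟨s', i', w', l'⟩ | ⟨s', i', w', p'⟩ | ⟨s', i', p', a'⟩) h hr
      · obtain ⟨rfl, rfl, ⟨rfl, h⟩ | ⟨_, h, _⟩⟩ := hostGraph_tri_tri.1 h
        · fin_cases l' <;> simp at h ⊢
        · simp at h
      · simp [hostRank] at hr
      · exact (hostGraph_tri_hub h).elim
  · refine ⟨tri s i w 1, hub s i p (w p), ?_⟩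
    rintro (⟨s', i', w', l'⟩ | ⟨s', i', w', p'⟩ | ⟨s', i', p', a'⟩) h hr
    · obtain ⟨rfl, rfl, rfl, rfl⟩ := hostGraph_sub_tri.1 h
      exact Or.inl rfl
    · exact (hostGraph_sub_sub h).elim
    · obtain ⟨rfl, rfl, rfl, rfl⟩ := hostGraph_sub_hub.1 h
      exact Or.inr rfl
  · refine ⟨hub (s + 1) i p a, hub (s + 1) i p a, ?_⟩
    rintro (⟨s', i', w', l'⟩ | ⟨s', i', w', p'⟩ | ⟨s', i', p', a'⟩) h hr
    · exact (hostGraph_hub_tri h).elim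
    · simp [hostRank] at hr
    · obtain ⟨h, rfl, rfl, rfl⟩ := hostGraph_hub_hub.1 h
      have : s' = s + 1 := by omega
      simp [this]

theorem degeneracy_map_hostGraph {k r n : ℕ} (hr : 1 ≤ r) (x y : (Fin k → Fin r) → Bool)
    (e : HostVertex k r ↪ Fin n) : degeneracy ((hostGraph x y).map e) = 2 := by
  have hadj : ∀ l l' : Fin 3, l ≠ l' → ((hostGraph x y).map e).Adj
      (e (tri 0 0 (fun _ => ⟨0, hr⟩) l)) (e (tri 0 0 (fun _ => ⟨0, hr⟩) l')) := fun l l' h =>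
    SimpleGraph.map_adj_apply.2 (hostGraph_tri_tri.2 ⟨rfl, rfl, Or.inl ⟨rfl, h⟩⟩)
  -- Vertices outside the range of `e` are isolated padding, so their default rank is irrelevant.
  refine degeneracy_eq_two _ (isDegenerate_two_of_rank _ (Function.extend e hostRank 0) ?_)
    (hadj 0 1 (by decide)) (hadj 1 2 (by decide)) (hadj 0 2 (by decide))
  intro v
  by_cases hv : ∃ u, e u = v
  · obtain ⟨u, rfl⟩ := hv
    obtain ⟨a, b, hab⟩ := hostGraph_rank x y u
    refine ⟨e a, e b, ?_⟩
    intro w hw hle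
    obtain ⟨u', w', h, h1, rfl⟩ := (SimpleGraph.map_adj _ _ _ _).1 hw
    obtain rfl := e.injective h1
    rw [e.injective.extend_apply, e.injective.extend_apply] at hle
    exact (hab w' h hle).imp (congrArg e) (congrArg e)
  · refine ⟨v, v, fun w hw _ => (hv ?_).elim⟩
    obtain ⟨u', _, _, h1, _⟩ := (SimpleGraph.map_adj _ _ _ _).1 hw
    exact ⟨u', h1⟩

/-! ### Occurrences of the pattern -/

/-- The standard copy of the pattern graph at an index `w`. -/
def hostCopy {k r : ℕ} (w : Fin k → Fin r) : PatternVertex k → HostVertex k r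
  | .inl (s, i, l) => tri s i w l
  | .inr (i, p, q) =>
      if q = 0 then sub 0 i w p else if q = 1 then hub 0 i p (w p)
      else if q = 2 then hub 1 i p (w p) else sub 1 i w p

theorem patternGraph_isIndContained_hostGraph {k r : ℕ} {x y : (Fin k → Fin r) → Bool}
    {w : Fin k → Fin r} (hx : x w = true) (hy : y w = true) :
    (patternGraph k).IsIndContained (hostGraph x y) := by
  have hinj : Function.Injective (hostCopy w : PatternVertex k → HostVertex k r) := by
    rintro (⟨s, i, l⟩ | ⟨i, p, q⟩) (⟨s', i', l'⟩ | ⟨i', p', q'⟩) h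
    · simpa [hostCopy] using h
    · fin_cases q' <;> simp [hostCopy] at h
    · fin_cases q <;> simp [hostCopy] at h
    · fin_cases q <;> fin_cases q' <;> simp [hostCopy] at h ⊢ <;> grind
  have hif : ∀ s : Fin 2, (if s = 0 then x w else y w) = true := fun s => by
    split_ifs <;> assumption
  refine ⟨⟨⟨hostCopy w, hinj⟩, ?_⟩⟩
  rintro (⟨s, i, l⟩ | ⟨i, p, q⟩) (⟨s', i', l'⟩ | ⟨i', p', q'⟩)
  · simp only [Function.Embedding.coeFn_mk, hostCopy, hostGraph_tri_tri, patternGraph,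
      SimpleGraph.fromRel_adj, patternRel, hif]
    constructor
    · rintro ⟨rfl, _, ⟨rfl, h⟩ | ⟨h, rfl, rfl, _⟩⟩
      · exact ⟨by simpa using h, by simp [h]⟩
      · exact ⟨by simpa using h, by simp [h]⟩
    · rintro ⟨_, (⟨rfl, rfl, h⟩ | ⟨rfl, h, rfl, rfl⟩) | (⟨rfl, rfl, h⟩ | ⟨rfl, h, rfl, rfl⟩)⟩
      · simp [h]
      · simp [h]
      · simp [h.symm]
      · simp [Ne.symm h]
  · fin_cases q' <;>
      simp [hostCopy, hostGraph_tri_sub, hostGraph_tri_hub, patternGraph, patternRel] <;> tauto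
  · fin_cases q <;>
      simp [hostCopy, hostGraph_sub_tri, hostGraph_hub_tri, patternGraph, patternRel] <;> tauto
  · fin_cases q <;> fin_cases q' <;>
      simp [hostCopy, hostGraph_sub_sub, hostGraph_hub_sub, hostGraph_sub_hub, hostGraph_hub_hub,
        patternGraph, patternRel] <;> grind

/-- Subdivision nodes are pairwise non-adjacent, hubs form a matching, and triangle nodes never
touch hubs, so all three vertices are triangle nodes of one side and word. Between the two gadgets
there is at most one edge, so they lie in a single one. -/
theorem hostGraph_triangle {k r : ℕ} {x y : (Fin k → Fin r) → Bool} {u v w : HostVertex k r}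
    (huv : (hostGraph x y).Adj u v) (hvw : (hostGraph x y).Adj v w)
    (huw : (hostGraph x y).Adj u w) :
    ∃ s i f l₁ l₂ l₃, u = tri s i f l₁ ∧ v = tri s i f l₂ ∧ w = tri s i f l₃ ∧
      l₁ ≠ l₂ ∧ l₂ ≠ l₃ ∧ l₁ ≠ l₃ := by
  rcases u with ⟨s, i, f, l⟩ | ⟨s, i, f, p⟩ | ⟨s, i, p, a⟩ <;>
    rcases v with ⟨s', i', f', l'⟩ | ⟨s', i', f', p'⟩ | ⟨s', i', p', a'⟩ <;>
    rcases w with ⟨s'', i'', f'', l''⟩ | ⟨s'', i'', f'', p''⟩ | ⟨s'', i'', p'', a''⟩ <;>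
    simp only [hostGraph_tri_tri, hostGraph_tri_sub, hostGraph_tri_hub, hostGraph_sub_tri,
      hostGraph_sub_sub, hostGraph_sub_hub, hostGraph_hub_tri, hostGraph_hub_sub,
      hostGraph_hub_hub] at huv hvw huw
  · obtain ⟨rfl, rfl, h1⟩ := huv
    obtain ⟨rfl, rfl, h2⟩ := hvw
    obtain ⟨-, -, h3⟩ := huw
    have hi : i = i' ∧ i = i'' := by
      by_contra hne
      rcases h1 with h1 | h1 <;> rcases h2 with h2 | h2 <;> rcases h3 with h3 | h3 <;> omega
    obtain ⟨rfl, rfl⟩ := hi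
    simp only [true_and, ne_eq, not_true_eq_false, false_and, or_false] at h1 h2 h3
    exact ⟨s, i, f, l, l', l'', rfl, rfl, rfl, h1, h2, h3⟩
  all_goals omega

/-- Two adjacent triangles, one of which has a node with `k` disjoint paths of length two
leaving it, can only lie in the host graph in the intended way. -/
theorem hostGraph_half {k r : ℕ} {x y : (Fin k → Fin r) → Bool} (hk : 1 ≤ k)
    {a b : Fin 3 → HostVertex k r}
    (ha : ∀ l l', l ≠ l' → (hostGraph x y).Adj (a l) (a l'))
    (hb : ∀ l l', l ≠ l' → (hostGraph x y).Adj (b l) (b l'))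
    (hab : (hostGraph x y).Adj (a 0) (b 0)) (hne : ∀ l, b 0 ≠ a l)
    {u v : Fin k → HostVertex k r} (hu : Function.Injective u)
    (hau : ∀ p, (hostGraph x y).Adj (a 1) (u p)) (hua : ∀ p l, u p ≠ a l)
    (huv : ∀ p, (hostGraph x y).Adj (u p) (v p)) (hva : ∀ p, v p ≠ a 1) :
    ∃ s i f, ∃ π : Fin k → Fin k, Function.Injective π ∧
      (if s = 0 then x f else y f) = true ∧ ∀ p, v p = hub s i (π p) (f (π p)) := by
  obtain ⟨s, i, f, l₀, l₁, l₂, h0, h1, h2, h01, h12, h02⟩ := hostGraph_triangle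
    (ha 0 1 (by decide)) (ha 1 2 (by decide)) (ha 0 2 (by decide))
  obtain ⟨s', i', f', m₀, m₁, m₂, g0, -⟩ := hostGraph_triangle
    (hb 0 1 (by decide)) (hb 1 2 (by decide)) (hb 0 2 (by decide))
  have hall : ∀ l, ∃ j, a j = tri s i f l := by
    intro l
    have : l = l₀ ∨ l = l₁ ∨ l = l₂ := by omega
    rcases this with rfl | rfl | rfl
    exacts [⟨0, h0⟩, ⟨1, h1⟩, ⟨2, h2⟩]
  rw [h0, g0, hostGraph_tri_tri] at hab
  obtain ⟨rfl, rfl, ⟨rfl, _⟩ | ⟨_, rfl, _, hin⟩⟩ := hab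
  · obtain ⟨j, hj⟩ := hall m₀
    exact (hne j (g0.trans hj.symm)).elim
  -- Label `0` is taken by the node joined to the other triangle, so a neighbour of `a 1` outside
  -- its triangle must be a subdivision node, and this forces label `1`.
  have hsub : ∀ p, l₁ = 1 ∧ ∃ q, u p = sub s i f q := by
    intro p
    have hadj := hau p
    rw [h1] at hadj
    rcases hup : u p with ⟨s', i'', f', l'⟩ | ⟨s', i'', f', p'⟩ | ⟨s', i'', p', a'⟩ <;>
      rw [hup] at hadj
    · obtain ⟨rfl, rfl, ⟨rfl, _⟩ | ⟨_, h, _⟩⟩ := hostGraph_tri_tri.1 hadj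
      · obtain ⟨j, hj⟩ := hall l'
        exact (hua p j (hup.trans hj.symm)).elim
      · exact (h01 h.symm).elim
    · obtain ⟨rfl, rfl, rfl, h⟩ := hostGraph_tri_sub.1 hadj
      exact ⟨h, p', rfl⟩
    · exact (hostGraph_tri_hub hadj).elim
  have hl₁ := (hsub ⟨0, hk⟩).1
  choose π hπ using fun p => (hsub p).2
  refine ⟨s, i, f, π, fun p q hpq => hu (by rw [hπ, hπ, hpq]), hin, fun p => ?_⟩
  have hadj := huv p
  rw [hπ] at hadj
  rcases hvp : v p with ⟨s', i'', f', l'⟩ | ⟨s', i'', f', p'⟩ | ⟨s', i'', p', a'⟩ <;>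
    rw [hvp] at hadj
  · obtain ⟨rfl, rfl, rfl, rfl⟩ := hostGraph_sub_tri.1 hadj
    exact (hva p (by rw [hvp, h1, hl₁])).elim
  · exact (hostGraph_sub_sub hadj).elim
  · obtain ⟨rfl, rfl, rfl, rfl⟩ := hostGraph_sub_hub.1 hadj
    rfl

theorem exists_of_patternGraph_isContained_hostGraph {k r : ℕ} (hk : 1 ≤ k)
    {x y : (Fin k → Fin r) → Bool} (h : (patternGraph k).IsContained (hostGraph x y)) :
    ∃ w, x w = true ∧ y w = true := by
  obtain ⟨φ⟩ := h
  have hφ : Function.Injective φ := φ.injective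
  have hadj : ∀ {u v}, (patternGraph k).Adj u v → (hostGraph x y).Adj (φ u) (φ v) :=
    fun h => φ.toHom.map_adj h
  -- Only the paths between the first triangles of the two sides are needed; the second triangles
  -- serve to certify membership in `x` and `y`.
  have hhalf : ∀ (s : Fin 2) (q q' : Fin 4), (s = 0 ∧ q = 0 ∧ q' = 1) ∨ (s = 1 ∧ q = 3 ∧ q' = 2) →
      ∃ s' i f, ∃ π : Fin k → Fin k, Function.Injective π ∧
        (if s' = 0 then x f else y f) = true ∧
        ∀ p, φ (.inr (0, p, q')) = hub s' i (π p) (f (π p)) := by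
    intro s q q' hq
    refine hostGraph_half (x := x) (y := y) hk (a := fun l => φ (.inl (s, 0, l)))
      (b := fun l => φ (.inl (s, 1, l)))
      (u := fun p => φ (.inr (0, p, q))) (v := fun p => φ (.inr (0, p, q')))
      ?_ ?_ ?_ ?_ ?_ ?_ ?_ ?_ ?_
    · intro l l' hl
      exact hadj (by simp [patternGraph, patternRel, hl])
    · intro l l' hl
      exact hadj (by simp [patternGraph, patternRel, hl])
    · exact hadj (by simp [patternGraph, patternRel])
    · intro l hl
      have := hφ hl
      simp at this
    · intro p p' hp
      simpa using hφ hp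
    · intro p
      refine hadj ?_
      rcases hq with ⟨rfl, rfl, rfl⟩ | ⟨rfl, rfl, rfl⟩ <;> simp [patternGraph, patternRel]
    · intro p l hl
      have := hφ hl
      simp at this
    · intro p
      refine hadj ?_
      rcases hq with ⟨rfl, rfl, rfl⟩ | ⟨rfl, rfl, rfl⟩ <;> simp [patternGraph, patternRel]
    · intro p hl
      have := hφ hl
      simp at this
  obtain ⟨s, i, f, π, hπ, hin, hf⟩ := hhalf 0 0 1 (by simp)
  obtain ⟨s', i', f', π', -, hin', hf'⟩ := hhalf 1 3 2 (by simp)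
  have hmid : ∀ p, s ≠ s' ∧ i = i' ∧ π p = π' p ∧ f (π p) = f' (π' p) := by
    intro p
    have := hadj (u := .inr (0, p, 1)) (v := .inr (0, p, 2)) (by simp [patternGraph, patternRel])
    rwa [hf, hf', hostGraph_hub_hub] at this
  -- The `k` paths use distinct positions, hence all of them, and the hub matching compares the two
  -- words at each.
  have hff : f = f' := by
    funext p
    obtain ⟨q, rfl⟩ := (Finite.injective_iff_surjective.1 hπ) p
    obtain ⟨-, -, h1, h2⟩ := hmid q
    rw [h2, ← h1]
  subst hff
  have hss := (hmid ⟨0, hk⟩).1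
  refine ⟨f, ?_⟩
  by_cases h0 : s = 0
  · rw [if_pos h0] at hin
    rw [if_neg (by omega)] at hin'
    exact ⟨hin, hin'⟩
  · rw [if_neg h0] at hin
    rw [if_pos (by omega)] at hin'
    exact ⟨hin', hin⟩

/-- Without isolated vertices in `H`, a copy cannot use the padding vertices outside the range of
`e`. -/
theorem SimpleGraph.IsContained.of_map {W V V' : Type*} {H : SimpleGraph W} {G : SimpleGraph V}
    (e : V ↪ V') (hH : ∀ u, ∃ v, H.Adj u v) (h : H.IsContained (G.map e)) : H.IsContained G := by
  obtain ⟨φ⟩ := h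
  have hadj : ∀ {u v}, H.Adj u v → (G.map e).Adj (φ u) (φ v) := fun h => φ.toHom.map_adj h
  have hr : ∀ u, ∃ a, e a = φ u := by
    intro u
    obtain ⟨v, hv⟩ := hH u
    obtain ⟨a, _, _, ha, _⟩ := (SimpleGraph.map_adj _ _ _ _).1 (hadj hv)
    exact ⟨a, ha⟩
  choose ψ hψ using hr
  refine ⟨⟨⟨ψ, fun {u v} huv => ?_⟩, fun u v huv => φ.injective ?_⟩⟩
  · have := hadj huv
    rwa [← hψ, ← hψ, SimpleGraph.map_adj_apply] at this
  · have huv' : ψ u = ψ v := huv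
    change φ u = φ v
    rw [← hψ, ← hψ, huv']

theorem patternGraph_exists_adj (k : ℕ) (u : PatternVertex k) : ∃ v, (patternGraph k).Adj u v := by
  rcases u with ⟨s, i, l⟩ | ⟨i, p, q⟩
  · refine ⟨.inl (s, i, l + 1), ?_⟩
    fin_cases l <;> simp [patternGraph, patternRel]
  · refine ⟨.inr (i, p, if q = 0 then 1 else q - 1), ?_⟩
    fin_cases q <;> simp [patternGraph, patternRel]

/-- Detecting the pattern, induced or not, in a host graph decides set intersection. -/
theorem patternGraph_detect_iff {k r n : ℕ} (hk : 1 ≤ k) (x y : (Fin k → Fin r) → Bool)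
    (e : HostVertex k r ↪ Fin n) :
    ((patternGraph k).IsContained ((hostGraph x y).map e) ↔ ∃ w, x w = true ∧ y w = true) ∧
    ((patternGraph k).IsIndContained ((hostGraph x y).map e) ↔ ∃ w, x w = true ∧ y w = true) := by
  have h1 : (patternGraph k).IsContained ((hostGraph x y).map e) →
      ∃ w, x w = true ∧ y w = true := fun h =>
    exists_of_patternGraph_isContained_hostGraph hk (h.of_map e (patternGraph_exists_adj k))
  have h2 : (∃ w, x w = true ∧ y w = true) →
      (patternGraph k).IsIndContained ((hostGraph x y).map e) := fun ⟨w, hx, hy⟩ =>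
    (patternGraph_isIndContained_hostGraph hx hy).trans ⟨SimpleGraph.Embedding.map e _⟩
  exact ⟨⟨h1, fun h => (h2 h).isContained⟩, ⟨fun h => h1 h.isContained, h2⟩⟩

end HostGraphs

/-! ## The lower bound -/

section Networks

open HostVertex

variable {k r : ℕ}

theorem hostGraph_adj_congr {x x' y y' : (Fin k → Fin r) → Bool} {u v : HostVertex k r}
    (hx : u.side = 0 → x = x') (hy : u.side ≠ 0 → y = y') :
    (hostGraph x y).Adj u v ↔ (hostGraph x' y').Adj u v := by
  rcases u with ⟨s, i, w, l⟩ | ⟨s, i, w, p⟩ | ⟨s, i, p, a⟩ <;>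
    rcases v with ⟨s', i', w', l'⟩ | ⟨s', i', w', p'⟩ | ⟨s', i', p', a'⟩ <;>
    simp only [hostGraph_tri_tri, hostGraph_tri_sub, hostGraph_tri_hub, hostGraph_sub_tri,
      hostGraph_sub_sub, hostGraph_sub_hub, hostGraph_hub_tri, hostGraph_hub_sub,
      hostGraph_hub_hub]
  by_cases h : s = 0
  · rw [hx h]; simp only [h, if_true]
  · rw [hy h]; simp only [h, if_false]

/-- Only hub edges cross the cut; this is what makes it small. -/
theorem hostGraph_adj_of_side_ne {x y : (Fin k → Fin r) → Bool} {u v : HostVertex k r}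
    (h : (hostGraph x y).Adj u v) (hs : u.side ≠ v.side) :
    ∃ s i p a, u = hub s i p a ∧ v = hub (s + 1) i p a := by
  rcases u with ⟨s, i, w, l⟩ | ⟨s, i, w, p⟩ | ⟨s, i, p, a⟩ <;>
    rcases v with ⟨s', i', w', l'⟩ | ⟨s', i', w', p'⟩ | ⟨s', i', p', a'⟩ <;>
    simp only [hostGraph_tri_tri, hostGraph_tri_sub, hostGraph_tri_hub, hostGraph_sub_tri,
      hostGraph_sub_sub, hostGraph_sub_hub, hostGraph_hub_tri, hostGraph_hub_sub,
      hostGraph_hub_hub] at h <;> simp only [HostVertex.side] at hs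
  · exact absurd h.1 hs
  · exact absurd h.1 hs
  · exact absurd h.1.symm hs
  · exact absurd h.1 hs
  · exact absurd h.1.symm hs
  · obtain ⟨_, rfl, rfl, rfl⟩ := h
    exact ⟨s, i, p, a, rfl, by rw [show s' = s + 1 by omega]⟩

end Networks

/-- The easy direction of Yao's principle: the expected number of failing instances is at most a
third of them, so some outcome of the coins does no worse. -/
theorem exists_algorithm_of_solvable {n b T : ℕ} {F P : SimpleGraph (Fin n) → Prop}
    (h : DetSolvable b T F P ∨ RandSolvable b T F P) {J : Type} [Fintype J]
    (Gr : J → SimpleGraph (Fin n)) (hF : ∀ j, F (Gr j)) :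
    ∃ A : CongestAlgorithm n b,
      3 * Nat.card {j // ¬ A.CorrectOn T P (Gr j)} ≤ Fintype.card J := by
  classical
  rcases h with ⟨A, hA⟩ | ⟨A, hA⟩
  · refine ⟨A, ?_⟩
    have : IsEmpty {j // ¬ A.CorrectOn T P (Gr j)} := ⟨fun j => j.2 (hA _ (hF _))⟩
    simp
  · let _ := A.measurableSpace
    have := A.isProbabilityMeasure
    -- Error events need not be measurable; measurable hulls have the same measure.
    let E : J → Set A.Ω := fun j => toMeasurable A.μ {ω | ¬ (A.alg ω).CorrectOn T P (Gr j)}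
    have hE : ∀ j, MeasurableSet (E j) := fun j => measurableSet_toMeasurable _ _
    have hmeas : ∀ j ∈ (Finset.univ : Finset J), Measurable ((E j).indicator (1 : A.Ω → ℝ≥0∞)) :=
      fun j _ => measurable_one.indicator (hE j)
    obtain ⟨ω, hω⟩ := exists_le_lintegral (μ := A.μ)
      (f := fun ω => ∑ j, (E j).indicator (1 : A.Ω → ℝ≥0∞) ω)
      (Finset.measurable_fun_sum _ hmeas).aemeasurable
    rw [lintegral_finsetSum _ hmeas] at hω
    have hle : ∑ j, ∫⁻ ω, (E j).indicator (1 : A.Ω → ℝ≥0∞) ω ∂A.μ ≤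
        (Fintype.card J : ℝ≥0∞) * (1 / 3) := by
      refine (Finset.sum_le_card_nsmul _ _ (1 / 3 : ℝ≥0∞) fun j _ => ?_).trans_eq ?_
      · rw [lintegral_indicator_one (hE j), measure_toMeasurable]
        exact hA _ (hF j)
      · rw [nsmul_eq_mul, Finset.card_univ]
    have hcount : ((Nat.card {j // ¬ (A.alg ω).CorrectOn T P (Gr j)} : ℕ) : ℝ≥0∞) ≤
        ∑ j, (E j).indicator (1 : A.Ω → ℝ≥0∞) ω := by
      rw [Nat.card_eq_fintype_card, Fintype.card_subtype, ← nsmul_one, ← Finset.sum_const,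
        Finset.sum_filter]
      refine Finset.sum_le_sum fun j _ => ?_
      by_cases hj : (A.alg ω).CorrectOn T P (Gr j)
      · rw [if_neg (not_not.2 hj)]
        exact zero_le
      · rw [if_pos hj, Set.indicator_of_mem (subset_toMeasurable _ _ hj)]
        exact le_rfl
    refine ⟨A.alg ω, ?_⟩
    have h3 := mul_le_mul_right (hcount.trans (hω.trans hle)) (3 : ℝ≥0∞)
    rw [mul_comm (Fintype.card J : ℝ≥0∞), ← mul_assoc,
      ENNReal.mul_div_cancel (by norm_num) (by norm_num), one_mul] at h3
    exact_mod_cast h3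

theorem pow_le_of_detectable {k r n b T : ℕ} (hk : 1 ≤ k) (hr : 1 ≤ r)
    (e : HostVertex k r ↪ Fin n) (h : DetectableOnDegeneracyTwo (patternGraph k) n b T) :
    (r : ℝ) ^ k ≤ 1152 * (8 * k * r * (b * T) + 1) := by
  classical
  have hsolve : ∃ P : SimpleGraph (Fin n) → Prop,
      (DetSolvable b T (fun G => degeneracy G = 2) P ∨
        RandSolvable b T (fun G => degeneracy G = 2) P) ∧
      ∀ x y, P ((hostGraph (k := k) (r := r) x y).map e) ↔ ∃ w, x w = true ∧ y w = true := by
    rcases h with h | h | h | h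
    exacts [⟨_, Or.inl h, fun x y => (patternGraph_detect_iff hk x y e).1⟩,
      ⟨_, Or.inl h, fun x y => (patternGraph_detect_iff hk x y e).2⟩,
      ⟨_, Or.inr h, fun x y => (patternGraph_detect_iff hk x y e).1⟩,
      ⟨_, Or.inr h, fun x y => (patternGraph_detect_iff hk x y e).2⟩]
  obtain ⟨P, hP, hiff⟩ := hsolve
  obtain ⟨A, hA⟩ := exists_algorithm_of_solvable hP
    (fun j : HardSample (Fin k → Fin r) => (hostGraph j.fst j.snd).map e)
    (fun j => degeneracy_map_hostGraph hr _ _ e)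
  let side : Fin n → Prop := fun v => ∃ u, e u = v ∧ u.side = 0
  obtain ⟨τ, _, S, U, hcard, hrej, huniq⟩ := A.exists_rectangles T
    -- Each of the `2 k r` crossing edges is listed once per direction.
    (δ := Fin 2 × Fin 2 × Fin k × Fin r)
    (fun x y : (Fin k → Fin r) → Bool => (hostGraph x y).map e) side
    (fun d => e (.hub d.1 d.2.1 d.2.2.1 d.2.2.2)) (fun d => e (.hub (d.1 + 1) d.2.1 d.2.2.1 d.2.2.2))
    (by
      rintro x y y' v u ⟨v', rfl, hv⟩
      simp only [SimpleGraph.map_adj]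
      constructor <;>
      · rintro ⟨a, c, hac, ha, hc⟩
        obtain rfl := e.injective ha
        exact ⟨a, c, (hostGraph_adj_congr (fun _ => rfl) (fun h => (h hv).elim)).1 hac, ha, hc⟩)
    (by
      intro x x' y v u hv
      simp only [SimpleGraph.map_adj]
      constructor <;>
      · rintro ⟨a, c, hac, ha, hc⟩
        exact ⟨a, c, (hostGraph_adj_congr (fun h => (hv ⟨a, ha, h⟩).elim) (fun _ => rfl)).1 hac,
          ha, hc⟩)
    (by
      intro x y v u hvu hs
      obtain ⟨a, c, hac, rfl, rfl⟩ := (SimpleGraph.map_adj _ _ _ _).1 hvu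
      have hside : ∀ a, side (e a) ↔ a.side = 0 := fun a =>
        ⟨fun ⟨a', ha', h⟩ => e.injective ha' ▸ h, fun h => ⟨a, rfl, h⟩⟩
      rw [hside, hside] at hs
      obtain ⟨s, i, p, a', rfl, rfl⟩ := hostGraph_adj_of_side_ne hac (by
        intro he
        rw [he] at hs
        tauto)
      exact ⟨(s, i, p, a'), rfl, rfl⟩)
  have hmain := card_le_log_card_rectangles S U _ hrej huniq (by
    refine le_trans (le_of_eq ?_) hA
    rw [Nat.card_eq_fintype_card, Fintype.card_subtype]
    congr 2
    ext j
    simp only [Finset.mem_filter, Finset.mem_univ, true_and, CongestAlgorithm.CorrectOn, hiff])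
  have hlog : Real.log (Fintype.card τ) ≤ 8 * k * r * (b * T) := by
    have h1 : Real.log (Fintype.card τ) ≤
        Real.log (((4 ^ b) ^ (T * Fintype.card (Fin 2 × Fin 2 × Fin k × Fin r)) : ℕ) : ℝ) := by
      rcases Nat.eq_zero_or_pos (Fintype.card τ) with h0 | h0
      · rw [h0, Nat.cast_zero, Real.log_zero]
        exact Real.log_natCast_nonneg _
      · exact Real.log_le_log (by exact_mod_cast h0) (by exact_mod_cast hcard)
    have h2 : Real.log 4 ≤ 2 := by
      rw [show (4 : ℝ) = 2 ^ 2 by norm_num, Real.log_pow]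
      have := Real.log_two_lt_d9
      push_cast
      linarith
    refine h1.trans ?_
    simp only [Fintype.card_prod, Fintype.card_fin]
    push_cast
    rw [Real.log_pow, Real.log_pow]
    push_cast
    have := mul_le_mul_of_nonneg_left h2
      (show (0 : ℝ) ≤ T * (2 * (2 * (k * r))) * b by positivity)
    linarith
  have hN : ((Fintype.card (Fin k → Fin r) : ℕ) : ℝ) = (r : ℝ) ^ k := by simp
  rw [hN] at hmain
  linarith

theorem exists_detection_lower_bound {k : ℕ} (hk : 1 ≤ k) :
    ∃ c : ℝ, 0 < c ∧ ∃ n₀ : ℕ, ∀ n : ℕ, n₀ ≤ n → ∀ b T : ℕ,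
      DetectableOnDegeneracyTwo (patternGraph k) n b T →
        c * (n : ℝ) ^ (1 - 1 / (k : ℝ)) ≤ (b : ℝ) * (T : ℝ) := by
  have hk0 : (0 : ℝ) < k := by exact_mod_cast hk
  set q : ℝ := 12 + 8 * k with hq
  have hq1 : 1 ≤ q := by linarith
  -- The host has at most `q * r ^ k` vertices, so `r` is the floor of `(n / q) ^ (1 / k)`; rounding
  -- down loses at most a factor 2 in `r`. The threshold makes `r ≥ 2304 = 2 * 1152`, so the
  -- additive 1152 is at most half of `r ^ k`, and `18432 = 2 * 1152 * 8`.
  refine ⟨1 / (q * 2 ^ (k - 1) * (18432 * k)), by positivity, (12 + 8 * k) * 2304 ^ k, ?_⟩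
  intro n hn b T h
  set R : ℝ := (n / q) ^ (1 / (k : ℝ)) with hR
  have hR0 : 0 ≤ R := by positivity
  have hRk : R ^ k = n / q := by
    rw [hR, one_div, Real.rpow_inv_natCast_pow (by positivity) (by omega)]
  have hR1 : 2304 ≤ R := by
    refine le_of_pow_le_pow_left₀ (n := k) (by omega) hR0 ?_
    rw [hRk, le_div_iff₀ (by positivity), hq, mul_comm]
    exact_mod_cast hn
  set r : ℕ := ⌊R⌋₊ with hr
  have hrR : (r : ℝ) ≤ R := Nat.floor_le hR0
  have hRr : R < r + 1 := Nat.lt_floor_add_one R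
  have hr1 : 2304 ≤ r := Nat.le_floor (by exact_mod_cast hR1)
  have hr1' : (2304 : ℝ) ≤ r := by exact_mod_cast hr1
  have hcard : Fintype.card (HostVertex k r) ≤ Fintype.card (Fin n) := by
    refine (HostVertex.card_le hk).trans ?_
    rw [Fintype.card_fin]
    have h1 : (r : ℝ) ^ k ≤ n / q := hRk ▸ pow_le_pow_left₀ (by positivity) hrR k
    rw [le_div_iff₀ (by positivity), hq, mul_comm] at h1
    exact_mod_cast h1
  obtain ⟨e⟩ := Function.Embedding.nonempty_of_card_le hcard
  have hpow := pow_le_of_detectable hk (by omega) e h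
  obtain ⟨m, rfl⟩ : ∃ m, k = m + 1 := ⟨k - 1, by omega⟩
  rw [Nat.add_sub_cancel]
  have hrm : (r : ℝ) ^ m ≤ 18432 * (m + 1 : ℕ) * (b * T) := by
    have h1 : (2304 : ℝ) ≤ (r : ℝ) ^ (m + 1) := by
      refine hr1'.trans ?_
      exact le_self_pow₀ (by linarith) (by omega)
    have h2 : (r : ℝ) ^ m * r ≤ (18432 * (m + 1 : ℕ) * (b * T)) * r := by
      rw [← pow_succ]
      linarith
    exact le_of_mul_le_mul_right h2 (by linarith)
  have hnR : (n : ℝ) ^ (1 - 1 / ((m + 1 : ℕ) : ℝ)) ≤ q * R ^ m := by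
    have hn' : (n : ℝ) = q * R ^ (m + 1) := by
      rw [hRk]; field_simp
    have hexp : ((m + 1 : ℕ) : ℝ) * (1 - 1 / ((m + 1 : ℕ) : ℝ)) = (m : ℕ) := by
      field_simp
      push_cast
      ring
    rw [hn', Real.mul_rpow (by positivity) (by positivity), ← Real.rpow_natCast R (m + 1),
      ← Real.rpow_mul hR0, hexp, Real.rpow_natCast]
    refine mul_le_mul_of_nonneg_right ?_ (by positivity)
    refine (Real.rpow_le_rpow_of_exponent_le hq1 ?_).trans_eq (Real.rpow_one q)
    have : 0 ≤ 1 / ((m + 1 : ℕ) : ℝ) := by positivity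
    linarith
  have hRm : R ^ m ≤ 2 ^ m * (r : ℝ) ^ m := by
    rw [← mul_pow]
    exact pow_le_pow_left₀ hR0 (by linarith) m
  rw [one_div, inv_mul_le_iff₀ (by positivity)]
  calc (n : ℝ) ^ (1 - 1 / ((m + 1 : ℕ) : ℝ)) ≤ q * R ^ m := hnR
    _ ≤ q * (2 ^ m * (r : ℝ) ^ m) := mul_le_mul_of_nonneg_left hRm (by positivity)
    _ ≤ q * (2 ^ m * (18432 * (m + 1 : ℕ) * (b * T))) := by gcongr
    _ = _ := by ring

theorem DetectableOnDegeneracyTwo.congr {W W' : Type} {H : SimpleGraph W} {H' : SimpleGraph W'}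
    (e : H ≃g H') {n b T : ℕ} (h : DetectableOnDegeneracyTwo H n b T) :
    DetectableOnDegeneracyTwo H' n b T := by
  have h1 : (fun G : SimpleGraph (Fin n) => H.IsContained G) = fun G => H'.IsContained G := by
    funext G
    exact propext (SimpleGraph.isContained_congr_left e)
  have h2 : (fun G : SimpleGraph (Fin n) => H.IsIndContained G) = fun G => H'.IsIndContained G := by
    funext G
    exact propext ⟨fun ⟨f⟩ => ⟨f.comp e.symm.toEmbedding⟩, fun ⟨f⟩ => ⟨f.comp e.toEmbedding⟩⟩
  unfold DetectableOnDegeneracyTwo at h ⊢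
  rwa [h1, h2] at h

/-- The exponents differ by `ε = 1/k - 1/(k + 1) > 0`, and `log n ≤ n ^ ε / ε`. -/
theorem rounds_lower_bound_of_mul {k : ℕ} (hk : 1 ≤ k) {c₁ C : ℝ} (hc₁ : 0 < c₁) :
    ∃ c : ℝ, 0 < c ∧ ∀ n b T : ℕ, 1 ≤ n → (b : ℝ) ≤ C * Real.log n →
      c₁ * (n : ℝ) ^ (1 - 1 / ((k + 1 : ℕ) : ℝ)) ≤ (b : ℝ) * T →
      c * (n : ℝ) ^ (1 - 1 / (k : ℝ)) ≤ T := by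
  have hk0 : (0 : ℝ) < k := by exact_mod_cast hk
  set ε : ℝ := 1 / (k : ℝ) - 1 / ((k + 1 : ℕ) : ℝ) with hε
  have hε0 : 0 < ε := by
    rw [hε, sub_pos]
    exact one_div_lt_one_div_of_lt hk0 (by push_cast; linarith)
  -- `C` may be zero or negative, but the constant is divided by `D`.
  set D : ℝ := max C 1 with hD
  have hD0 : 0 < D := lt_of_lt_of_le one_pos (le_max_right _ _)
  refine ⟨c₁ * ε / D, by positivity, ?_⟩
  intro n b T hn hb h
  have hn0 : (0 : ℝ) < n := by exact_mod_cast hn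
  have hsplit : (n : ℝ) ^ (1 - 1 / ((k + 1 : ℕ) : ℝ)) =
      (n : ℝ) ^ (1 - 1 / (k : ℝ)) * (n : ℝ) ^ ε := by
    rw [← Real.rpow_add hn0]
    congr 1
    rw [hε]
    ring
  have hlog : Real.log n ≤ (n : ℝ) ^ ε / ε := Real.log_le_rpow_div hn0.le hε0
  have hbD : (b : ℝ) ≤ D * ((n : ℝ) ^ ε / ε) :=
    calc (b : ℝ) ≤ C * Real.log n := hb
      _ ≤ D * Real.log n :=
        mul_le_mul_of_nonneg_right (le_max_left _ _) (Real.log_natCast_nonneg n)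
      _ ≤ _ := mul_le_mul_of_nonneg_left hlog hD0.le
  have hfin := h.trans (mul_le_mul_of_nonneg_right hbD (Nat.cast_nonneg T))
  rw [hsplit] at hfin
  have hpos : 0 < (n : ℝ) ^ ε := Real.rpow_pos_of_pos hn0 ε
  refine le_of_mul_le_mul_right (a := D / ε * (n : ℝ) ^ ε) ?_ (by positivity)
  calc c₁ * ε / D * (n : ℝ) ^ (1 - 1 / (k : ℝ)) * (D / ε * (n : ℝ) ^ ε)
      = c₁ * ((n : ℝ) ^ (1 - 1 / (k : ℝ)) * (n : ℝ) ^ ε) := by field_simp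
    _ ≤ D * ((n : ℝ) ^ ε / ε) * T := hfin
    _ = T * (D / ε * (n : ℝ) ^ ε) := by ring

/-- For each `k ≥ 2`:
* the pattern graph with `k` paths has treewidth `2`, and detecting it, induced or not, with
  bandwidth `b` on graphs of degeneracy `2` needs at least `c * n ^ (1 - 1/k) / b` rounds;
* for some pattern of treewidth `2`, with bandwidth `O(log n)` even `Ω(n ^ (1 - 1/k))` rounds
  are needed. -/
theorem mainTheorem8 (k : ℕ) (hk : 2 ≤ k) :
    (treewidth (patternGraph k) = 2 ∧
      ∃ c : ℝ, 0 < c ∧ ∃ n₀ : ℕ, ∀ n : ℕ, n₀ ≤ n → ∀ b T : ℕ,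
        DetectableOnDegeneracyTwo (patternGraph k) n b T →
          c * (n : ℝ) ^ (1 - 1 / (k : ℝ)) ≤ (b : ℝ) * (T : ℝ)) ∧
    (∃ (m : ℕ) (H : SimpleGraph (Fin m)), treewidth H = 2 ∧
      ∀ C : ℝ, ∃ c : ℝ, 0 < c ∧ ∃ n₀ : ℕ, ∀ n : ℕ, n₀ ≤ n → ∀ b T : ℕ,
        (b : ℝ) ≤ C * Real.log n → DetectableOnDegeneracyTwo H n b T →
          c * (n : ℝ) ^ (1 - 1 / (k : ℝ)) ≤ (T : ℝ)) := by
  refine ⟨⟨treewidth_patternGraph k, exists_detection_lower_bound (by omega)⟩, ?_⟩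
  let v : PatternVertex (k + 1) ≃ Fin (Fintype.card (PatternVertex (k + 1))) :=
    Fintype.equivFin _
  let e := SimpleGraph.Iso.map v (patternGraph (k + 1))
  refine ⟨_, (patternGraph (k + 1)).map v.toEmbedding,
    (treewidth_congr e).symm.trans (treewidth_patternGraph _), ?_⟩
  intro C
  obtain ⟨c₁, hc₁, n₁, hn₁⟩ := exists_detection_lower_bound (k := k + 1) (by omega)
  obtain ⟨c, hc, hmain⟩ := rounds_lower_bound_of_mul (k := k) (by omega) (C := C) hc₁
  refine ⟨c, hc, max n₁ 1, ?_⟩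
  intro n hn b T hb h
  exact hmain n b T (le_of_max_le_right hn) hb
    (hn₁ n (le_of_max_le_left hn) b T (h.congr e.symm))
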